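/- Let $\Lambda$ be a semigroup with a finite generating subset $F$ (every element of $\Lambda$ is a nonempty product of elements of $F$), let $1\le i<d$ be integers, and let $\rho:\Lambda\to\mathrm{GL}(d,\mathbb R)$ be a semigroup homomorphism. Let $|\gamma|_F$ be the least $k\ge 1$ such that $\gamma$ is a product of $k$ elements of $F$, except that $|e|_F=0$ if $\Lambda$ has an identity element $e$. For $g\in\mathrm{GL}(d,\mathbb R)$ let $\mu_1(g)\ge\dots\ge\mu_d(g)$ be the logarithms of its singular values and, when $\mu_i(g)>\mu_{i+1}(g)$, let $\Xi_i(g)\in\mathrm{Gr}_i(\mathbb R^d)$ be the sum of the eigenspaces of $gg^t$ for the eigenvalues $e^{2\mu_1(g)},\dots,e^{2\mu_i(g)}$. For $\kappa\in(0,1]$ and $\kappa'\ge 0$ let $$\mathcal{QG}_F^{\kappa,\kappa'}=\{(f_k)_{k\in\mathbb N}\in F^{\mathbb N} : |f_k\cdots f_{k+\ell}|_F\ge\kappa(\ell+1)-\kappa'\ \ \forall k,\ell\in\mathbb N\},$$ a compact subset of $F^{\mathbb N}$ invariant under the shift $\sigma$, and let $\mathcal{QG}_F=\bigcup_{\kappa\in(0,1],\,\kappa'\ge0}\mathcal{QG}_F^{\kappa,\kappa'}$,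 with the inductive limit topology (a map on $\mathcal{QG}_F$ is continuous if and only if its restriction to each $\mathcal{QG}_F^{\kappa,\kappa'}$ is). Let $\Phi_\rho((f_k)_k)=\rho(f_0)^{-1}$. A linear cocycle $(T,\Phi)$ over a compact metrizable space $X$, with $\Phi:X\to\mathrm{GL}(d,\mathbb R)$, has a dominated splitting of index $j$, given by $E$, if $E:X\to\mathrm{Gr}_{d-j}(\mathbb R^d)$ is continuous, $\Phi(x)E(x)=E(Tx)$ for all $x\in X$, and there are $C,C'>0$ such that $\log\|\Phi^{(n)}(x)w\|-\log\|\Phi^{(n)}(x)v\|\ge Cn-C'$ for all $n\in\mathbb N$, $x\in X$ and unit vectors $v\in E(x)$, $w\in E(x)^\perp$, where $\Phi^{(n)}(x)=\Phi(T^{n-1}x)\cdots\Phi(x)$. Suppose that $\rho$ is $P_i$-Anosov, i.e. for some (equivalently, any) finite generating subset $F_0$ of $\Lambda$ there are $c,c'>0$ such that $\mu_i(\rho(\gamma))-\mu_{i+1}(\rho(\gamma))\ge c\,|\gamma|_{F_0}-c'$ for all $\gamma\in\Lambda$. Then for all $\kappa\in(0,1]$ and $\kappa'\ge0$ the linear cocycle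 $(\sigma,\Phi_\rho)$ over $\mathcal{QG}_F^{\kappa,\kappa'}$ has a dominated splitting of index $d-i$. In particular, for every $(f_k)_k\in\mathcal{QG}_F$ one has $\mu_i>\mu_{i+1}$ at $\rho(f_0\cdots f_{n-1})$ for all large $n$, and the map $$E^{cs}:\mathcal{QG}_F\to\mathrm{Gr}_i(\mathbb R^d),\qquad E^{cs}((f_k)_k)=\lim_{n\to+\infty}\Xi_i\big(\rho(f_0\cdots f_{n-1})\big)$$ is well defined, continuous, and equivariant, $E^{cs}(\sigma x)=\Phi_\rho(x)E^{cs}(x)$ for all $x\in\mathcal{QG}_F$; the dominated splitting over each $\mathcal{QG}_F^{\kappa,\kappa'}$ is given by the restriction of $E^{cs}$. -/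

import Mathlib

noncomputable section

namespace SemigroupAnosov

/-! ### Linear algebra: singular values, Grassmannians, top singular subspaces -/

/-- `ℝ^d` with its standard Euclidean norm. -/
abbrev Euc (d : ℕ) : Type := EuclideanSpace ℝ (Fin d)

/-- The linear action of a matrix on `ℝ^d`. -/
def act {d : ℕ} (A : Matrix (Fin d) (Fin d) ℝ) : Euc d →ₗ[ℝ] Euc d := Matrix.toEuclideanLin A

/-- `mu g j` is `μ_j(g)`, the logarithm of the `j`-th largest singular value of `g`, for
`1 ≤ j ≤ d` (Mathlib's decreasing list of singular values is indexed from `0`). -/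
def mu {d : ℕ} (g : GL (Fin d) ℝ) (j : ℕ) : ℝ :=
  Real.log ((act (g : Matrix (Fin d) (Fin d) ℝ)).singularValues (j - 1))

/-- `Xi j g` is the sum of the eigenspaces of `g gᵗ` for the eigenvalues
`e^{2 μ_1(g)}, …, e^{2 μ_j(g)}`. It is `j`-dimensional as soon as `μ_j(g) > μ_{j+1}(g)`. -/
def Xi {d : ℕ} (j : ℕ) (g : GL (Fin d) ℝ) : Submodule ℝ (Euc d) :=
  ⨆ k ∈ Finset.Icc 1 j,
    Module.End.eigenspace
      (act ((g : Matrix (Fin d) (Fin d) ℝ) * (g : Matrix (Fin d) (Fin d) ℝ).transpose))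
      (Real.exp (2 * mu g k))

/-- The Grassmannian of `k`-planes of `ℝ^d`. -/
def Gr (k d : ℕ) : Type := {V : Submodule ℝ (Euc d) // Module.finrank ℝ V = k}

/-- The usual topology of the Grassmannian, that of the metric
`d(V, W) = ‖P_V - P_W‖`, where `P_V` is the orthogonal projection of `ℝ^d` onto `V`. -/
instance (k d : ℕ) : TopologicalSpace (Gr k d) :=
  TopologicalSpace.induced (fun V : Gr k d => V.1.starProjection) inferInstance

/-- The sequence `V n` of subspaces is made of `k`-planes for all large `n`, and converges to `W`
in the Grassmannian of `k`-planes. -/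
def ConvergesInGr {k d : ℕ} (V : ℕ → Submodule ℝ (Euc d)) (W : Gr k d) : Prop :=
  ∃ u : ℕ → Gr k d, (∀ᶠ n in Filter.atTop, (u n).1 = V n) ∧
    Filter.Tendsto u Filter.atTop (nhds W)

/-! ### Linear cocycles and dominated splittings -/

/-- A linear cocycle over a compact metrizable space. -/
structure LinearCocycle (X : Type*) [TopologicalSpace X] [CompactSpace X]
    [TopologicalSpace.MetrizableSpace X] (d : ℕ) where
  /-- the dynamics on the base -/
  T : X → X
  /-- the generator of the cocycle -/
  Φ : X → GL (Fin d) ℝ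
  continuous_T : Continuous T
  continuous_Φ : Continuous Φ

section Cocycle

variable {X : Type*} [TopologicalSpace X] [CompactSpace X] [TopologicalSpace.MetrizableSpace X]
  {d : ℕ}

/-- `Φ^{(n)}(x) = Φ(T^{n-1} x) ⋯ Φ(x)`. -/
def LinearCocycle.iter (c : LinearCocycle X d) : ℕ → X → GL (Fin d) ℝ
  | 0, _ => 1
  | n + 1, x => c.Φ (c.T^[n] x) * c.iter n x

/-- `E` is a continuous equivariant bundle of `k`-planes which is dominated by its orthogonal
complement under the cocycle. -/
def LinearCocycle.IsDominatedBundle (c : LinearCocycle X d) {k : ℕ} (E : X → Gr k d) : Prop :=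
  Continuous E ∧
  (∀ x, (E x).1.map (act (c.Φ x : Matrix (Fin d) (Fin d) ℝ)) = (E (c.T x)).1) ∧
  ∃ C C' : ℝ, 0 < C ∧ 0 < C' ∧ ∀ (n : ℕ) (x : X) (v w : Euc d),
    v ∈ (E x).1 → ‖v‖ = 1 → w ∈ ((E x).1)ᗮ → ‖w‖ = 1 →
    C * n - C' ≤ Real.log ‖act (c.iter n x : Matrix (Fin d) (Fin d) ℝ) w‖
      - Real.log ‖act (c.iter n x : Matrix (Fin d) (Fin d) ℝ) v‖

/-- Dominated splitting of index `j`: the bundle `E^{cs}` consists of `(d - j)`-planes. -/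
def LinearCocycle.HasDominatedSplitting (c : LinearCocycle X d) (j : ℕ) : Prop :=
  ∃ k : ℕ, k + j = d ∧ ∃ E : X → Gr k d, c.IsDominatedBundle E

end Cocycle

/-! ### Words in a semigroup, Anosov homomorphisms -/

section Semi

variable {Λ : Type*} [Semigroup Λ]

/-- `wordProd f k ℓ = f_k f_{k+1} ⋯ f_{k+ℓ}`, a product of `ℓ + 1` factors. -/
def wordProd (f : ℕ → Λ) (k : ℕ) : ℕ → Λ
  | 0 => f k
  | ℓ + 1 => wordProd f k ℓ * f (k + (ℓ + 1))

/-- `F` generates the semigroup: every element is a (nonempty) product of elements of `F`. -/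
def Generates (F : Finset Λ) : Prop := Subsemigroup.closure (F : Set Λ) = ⊤

open Classical in
/-- The word length `|γ|_F`: `0` for the identity element (if there is one), and otherwise the
least `k ≥ 1` such that `γ` is a product of `k` elements of `F`. -/
def wordLength (F : Finset Λ) (γ : Λ) : ℕ :=
  if ∀ x : Λ, γ * x = x ∧ x * γ = x then 0
  else sInf {k : ℕ | ∃ ℓ : ℕ, k = ℓ + 1 ∧ ∃ f : ℕ → Λ, (∀ j, f j ∈ F) ∧ wordProd f 0 ℓ = γ}

/-- Uniform `i`-gap in singular values, with respect to `F`. -/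
def UniformSingularGap {d : ℕ} (F : Finset Λ) (ρ : Λ →ₙ* GL (Fin d) ℝ) (i : ℕ) : Prop :=
  ∃ c c' : ℝ, 0 < c ∧ 0 < c' ∧
    ∀ γ : Λ, c * (wordLength F γ : ℝ) - c' ≤ mu (ρ γ) i - mu (ρ γ) (i + 1)

/-- `ρ` is `P_i`-Anosov: it has a uniform `i`-gap in singular values with respect to some
(equivalently, any) finite generating subset. -/
def IsAnosov {d : ℕ} (ρ : Λ →ₙ* GL (Fin d) ℝ) (i : ℕ) : Prop :=
  ∃ F : Finset Λ, Generates F ∧ UniformSingularGap F ρ i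

/-! ### Quasigeodesic shift spaces -/

/-- The finite alphabet `F`, as a discrete space. -/
def Letter (F : Finset Λ) : Type _ := {f : Λ // f ∈ F}

instance (F : Finset Λ) : TopologicalSpace (Letter F) := ⊥
instance (F : Finset Λ) : DiscreteTopology (Letter F) := ⟨rfl⟩
instance (F : Finset Λ) : Finite (Letter F) := inferInstanceAs (Finite {f : Λ // f ∈ F})

/-- The underlying sequence of elements of the semigroup. -/
def letters {F : Finset Λ} (x : ℕ → Letter F) : ℕ → Λ := fun k => (x k).1

/-- `QG_F^{κ,κ'}`, a subset of `F^ℕ` (with the product topology). -/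
def QG (F : Finset Λ) (κ κ' : ℝ) : Set (ℕ → Letter F) :=
  {x | ∀ k ℓ : ℕ, κ * ((ℓ : ℝ) + 1) - κ' ≤ (wordLength F (wordProd (letters x) k ℓ) : ℝ)}

/-- The shift on `F^ℕ`. -/
def shift {F : Finset Λ} (x : ℕ → Letter F) : ℕ → Letter F := fun k => x (k + 1)

theorem wordProd_shift {F : Finset Λ} (x : ℕ → Letter F) (k ℓ : ℕ) :
    wordProd (letters (shift x)) k ℓ = wordProd (letters x) (k + 1) ℓ := by
  induction ℓ with
  | zero => rfl
  | succ ℓ ih =>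
    simp only [wordProd, ih]
    simp only [letters, shift]
    congr 3
    omega

theorem shift_mem_QG {F : Finset Λ} {κ κ' : ℝ} {x : ℕ → Letter F} (hx : x ∈ QG F κ κ') :
    shift x ∈ QG F κ κ' := fun k ℓ => by
  rw [wordProd_shift]
  exact hx (k + 1) ℓ

theorem continuous_wordProd {F : Finset Λ} {Y : Type*} [TopologicalSpace Y] [DiscreteTopology Y]
    (φ : Λ → Y) (k ℓ : ℕ) :
    Continuous fun x : ℕ → Letter F => φ (wordProd (letters x) k ℓ) := by
  let _ : TopologicalSpace Λ := ⊥
  have _ : DiscreteTopology Λ := ⟨rfl⟩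
  have hl : ∀ m : ℕ, Continuous fun x : ℕ → Letter F => letters x m := fun m =>
    (continuous_of_discreteTopology (f := fun a : Letter F => (a.1 : Λ))).comp
      (continuous_apply m)
  have h : Continuous fun x : ℕ → Letter F => wordProd (letters x) k ℓ := by
    induction ℓ with
    | zero => exact hl k
    | succ ℓ ih =>
      exact (continuous_of_discreteTopology (f := fun p : Λ × Λ => p.1 * p.2)).comp
        (ih.prodMk (hl _))
  exact continuous_of_discreteTopology.comp h

theorem isClosed_QG (F : Finset Λ) (κ κ' : ℝ) : IsClosed (QG F κ κ') := by
  have : QG F κ κ' = ⋂ k : ℕ, ⋂ ℓ : ℕ,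
      {x | κ * ((ℓ : ℝ) + 1) - κ' ≤ (wordLength F (wordProd (letters x) k ℓ) : ℝ)} := by
    ext x
    simp [QG]
  rw [this]
  refine isClosed_iInter fun k => isClosed_iInter fun ℓ => isClosed_le continuous_const ?_
  exact (continuous_of_discreteTopology (f := fun n : ℕ => (n : ℝ))).comp
    (continuous_wordProd (wordLength F) k ℓ)

instance (F : Finset Λ) (κ κ' : ℝ) : CompactSpace (QG F κ κ') :=
  isCompact_iff_compactSpace.mp (isClosed_QG F κ κ').isCompact

/-- The cocycle `(σ, Φ_ρ)` over `QG_F^{κ,κ'}`, with `Φ_ρ((f_k)) = ρ(f_0)⁻¹`. -/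
def qgCocycle {d : ℕ} (ρ : Λ →ₙ* GL (Fin d) ℝ) (F : Finset Λ) (κ κ' : ℝ) :
    LinearCocycle (QG F κ κ') d where
  T x := ⟨shift x.1, shift_mem_QG x.2⟩
  Φ x := (ρ (letters x.1 0))⁻¹
  continuous_T := ((continuous_pi fun k => continuous_apply (k + 1)).comp
    continuous_subtype_val).subtype_mk _
  continuous_Φ :=
    (continuous_of_discreteTopology (f := fun a : Letter F => (ρ (a.1 : Λ))⁻¹)).comp
      ((continuous_apply 0).comp continuous_subtype_val)

/-- `QG_F`, the union of the `QG_F^{κ,κ'}` over `κ ∈ (0,1]` and `κ' ≥ 0`. -/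
def QGUnion (F : Finset Λ) : Type _ :=
  {x : ℕ → Letter F // ∃ κ κ' : ℝ, 0 < κ ∧ κ ≤ 1 ∧ 0 ≤ κ' ∧ x ∈ QG F κ κ'}

/-- The inclusion of `QG_F^{κ,κ'}` into `QG_F`. -/
def QGUnion.incl {F : Finset Λ} {κ κ' : ℝ} (h0 : 0 < κ) (h1 : κ ≤ 1) (h' : 0 ≤ κ')
    (x : QG F κ κ') : QGUnion F := ⟨x.1, κ, κ', h0, h1, h', x.2⟩

/-- `QG_F` carries the inductive limit topology of the increasing family of compact spaces
`QG_F^{κ,κ'}`: a map on `QG_F` is continuous if and only if its restriction to each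
`QG_F^{κ,κ'}` is. -/
instance (F : Finset Λ) : TopologicalSpace (QGUnion F) :=
  ⨆ (κ : ℝ) (κ' : ℝ) (h0 : 0 < κ) (h1 : κ ≤ 1) (h' : 0 ≤ κ'),
    TopologicalSpace.coinduced (QGUnion.incl (F := F) (κ := κ) (κ' := κ') h0 h1 h') inferInstance

/-- The shift on `QG_F`. -/
def QGUnion.shift {F : Finset Λ} (x : QGUnion F) : QGUnion F :=
  ⟨SemigroupAnosov.shift x.1, by
    obtain ⟨κ, κ', h0, h1, h', hx⟩ := x.2
    exact ⟨κ, κ', h0, h1, h', shift_mem_QG hx⟩⟩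

/-- The map `Φ_ρ` on `QG_F`. -/
def QGUnion.Phi {d : ℕ} {F : Finset Λ} (ρ : Λ →ₙ* GL (Fin d) ℝ) (x : QGUnion F) : GL (Fin d) ℝ :=
  (ρ (letters x.1 0))⁻¹

end Semi

end SemigroupAnosov

end

open SemigroupAnosov

namespace SemigroupAnosov

open Filter Topology

/-! ### Operators with a gap in a C⋆-algebra -/

section Gap

variable {𝔄 : Type*} [NormedRing 𝔄]

/-! Put `i = k + 1` and let `A_n(x)` be the product of the matrices of the first `n` letters of `x`;
the `n`-th iterate of the cocycle is `A_n(x)⁻¹`. Subwords of a quasigeodesic sequence have linearly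
growing length, whatever the finite generating set, so the Anosov gap gives `sv (k + 1) ≤ C θ^n sv
k` for `A_n(x)`, with `θ < 1` uniform in `x` (`exists_sv_ratio_of_isAnosov`).

One more letter changes singular values by bounded factors. Hence the left singular projections of
`A_n(x)` form a Cauchy sequence with uniform geometric rate, and their limit `P x` is continuous and
equivariant (`GapSystem.exists_limit`). A unit vector orthogonal to `P x` is stretched by `A_n(x)⁻¹`
by at least `1 / (2 sv (k + 1))` for large `n` (`le_sv_mul_norm_act_inv`).

The hard point is that `A_n(x)⁻¹` is bounded by a multiple of `1 / sv k` on `P x`. This requires `P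
(T^n x)` to be uniformly transverse to the kernel of the right singular projection of `A_n(x)`. In
the exterior power of degree `k + 1` it becomes the bound `c ‖A_n(x)‖ ≤ ‖A_n(x) P (T^n x)‖` of
`GapSystem.exists_norm_prods_mul_ge`, proved by contradiction. If it fails, there are times after
which all products of a given length `n` are small on the range of `P`, while they are always small
modulo the range of `P`. Moving `P` through such a product letter by letter (`norm_prods_le_sum`)
bounds its norm by `θ^n` times a sum of products of norms of shorter pieces. The limsups of the
log-norms along these times are subadditive, and such an exponential gain at every scale contradicts
Fekete's lemma (`Subadditive.not_forall_exp_le`). Transversality descends to `ℝ^d` through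
`exists_mul_compression_eq_mask`, and domination follows in `exists_norm_act_inv_le`. -/

theorem norm_mul_le_of_le_of_le {x y : 𝔄} {r s : ℝ} (hx : ‖x‖ ≤ r) (hy : ‖y‖ ≤ s) :
    ‖x * y‖ ≤ r * s :=
  (norm_mul_le _ _).trans
    (mul_le_mul hx hy (norm_nonneg _) ((norm_nonneg _).trans hx))

variable [StarRing 𝔄]

/-- `A` maps the range of the projection `S` onto the range of the projection `Q`, expanding it at
least by `a`, and it maps the kernel of `S` to the kernel of `Q`, with norm at most `b`. -/
structure Gap (A : 𝔄ˣ) (Q S : 𝔄) (a b : ℝ) : Prop where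
  left : IsStarProjection Q
  right : IsStarProjection S
  comm : (A : 𝔄) * S = Q * A
  lower : ‖S * (↑A⁻¹ : 𝔄)‖ ≤ 1 / a
  upper : ‖(A : 𝔄) * (1 - S)‖ ≤ b

theorem Gap.inv_comm {A : 𝔄ˣ} {Q S : 𝔄} {a b : ℝ} (h : Gap A Q S a b) :
    (↑A⁻¹ : 𝔄) * Q = S * (↑A⁻¹ : 𝔄) := by
  rw [Units.inv_mul_eq_iff_eq_mul, ← mul_assoc, h.comm, mul_assoc, Units.mul_inv, mul_one]

theorem Gap.upper_comm {A : 𝔄ˣ} {Q S : 𝔄} {a b : ℝ} (h : Gap A Q S a b) :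
    (1 - Q) * (A : 𝔄) = A * (1 - S) := by
  rw [sub_mul, mul_sub, h.comm, one_mul, mul_one]

/-- Inserting `A * A⁻¹` before `Q` writes the defect as the weak part of `g * A` after the inverse
of the strong part of `A`. In the limit this becomes equivariance of the bundle. -/
theorem Gap.norm_compl_mul_left_shift {A g : 𝔄ˣ} {Q S Q' S' : 𝔄} {a b a' b' : ℝ}
    (h : Gap A Q S a b) (h' : Gap (g * A) Q' S' a' b') :
    ‖(1 - Q') * (g : 𝔄) * Q‖ ≤ b' * (1 / a) := by
  have e : (1 - Q') * (g : 𝔄) * Q = (((g * A : 𝔄ˣ) : 𝔄) * (1 - S')) * (S * (↑A⁻¹ : 𝔄)) := by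
    rw [← h'.upper_comm, ← h.inv_comm, Units.val_mul]
    simp only [mul_assoc, Units.mul_inv_cancel_left]
  rw [e]
  exact norm_mul_le_of_le_of_le h'.upper h.lower

variable [CStarRing 𝔄]

/-- Adjoints exchange the two projections, so each estimate on left projections yields one on right
projections. -/
theorem Gap.star {A : 𝔄ˣ} {Q S : 𝔄} {a b : ℝ} (h : Gap A Q S a b) :
    Gap (star A) S Q a b where
  left := h.right
  right := h.left
  comm := by
    have := congrArg Star.star h.comm
    rw [star_mul, star_mul, h.left.isSelfAdjoint.star_eq, h.right.isSelfAdjoint.star_eq] at this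
    rw [Units.coe_star, this]
  lower := by
    have : Q * (↑(Star.star A)⁻¹ : 𝔄) = Star.star ((↑A⁻¹ : 𝔄) * Q) := by
      rw [star_mul, h.left.isSelfAdjoint.star_eq, Units.coe_star_inv]
    rw [this, norm_star, h.inv_comm]
    exact h.lower
  upper := by
    have : (↑(Star.star A) : 𝔄) * (1 - Q) = Star.star ((1 - Q) * (A : 𝔄)) := by
      rw [star_mul, star_sub, h.left.isSelfAdjoint.star_eq, Units.coe_star, star_one]
    rw [this, norm_star, h.upper_comm]
    exact h.upper

/-- The left projections of `A` and `A * B` are close if `A` and `A * B` have large gaps. -/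
theorem Gap.norm_left_sub_le {A B : 𝔄ˣ} {Q S Q' S' : 𝔄} {a b a' b' K ε : ℝ}
    (h : Gap A Q S a b) (h' : Gap (A * B) Q' S' a' b') (ha : 0 < a) (ha' : 0 < a')
    (hK : 0 ≤ K) (hε : 0 ≤ ε)
    (hB : ‖(B : 𝔄)‖ ≤ K) (hB' : ‖(↑B⁻¹ : 𝔄)‖ ≤ K) (hb : b ≤ ε * a) (hb' : b' ≤ ε * a')
    (haa' : a ≤ K * a') (ha'a : a' ≤ K * a) : ‖Q - Q'‖ ≤ 2 * K ^ 2 * ε := by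
  have h1 : ‖(1 - Q) * Q'‖ ≤ K ^ 2 * ε := by
    -- The outer factors have norms at most `b` and `1 / a'`, and only the bounded `B` stands
    -- between them.
    have e : (1 - Q) * Q' = ((A : 𝔄) * (1 - S)) * B * (S' * (↑(A * B)⁻¹ : 𝔄)) := by
      rw [← h.upper_comm, ← h'.inv_comm, mul_assoc (1 - Q), ← Units.val_mul, mul_assoc (1 - Q),
        Units.mul_inv_cancel_left]
    rw [e]
    refine (norm_mul_le_of_le_of_le (norm_mul_le_of_le_of_le h.upper hB) h'.lower).trans ?_
    rw [mul_one_div, div_le_iff₀ ha']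
    calc b * K ≤ (ε * (K * a')) * K := by gcongr; exact hb.trans (by gcongr)
      _ = K ^ 2 * ε * a' := by ring
  have h2 : ‖(1 - Q') * Q‖ ≤ K ^ 2 * ε := by
    have e : (1 - Q') * Q = (((A * B : 𝔄ˣ) : 𝔄) * (1 - S')) * (↑B⁻¹ : 𝔄) * (S * (↑A⁻¹ : 𝔄)) := by
      rw [← h'.upper_comm, ← h.inv_comm, Units.val_mul]
      simp only [mul_assoc, Units.mul_inv_cancel_left]
    rw [e]
    refine (norm_mul_le_of_le_of_le (norm_mul_le_of_le_of_le h'.upper hB') h.lower).trans ?_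
    rw [mul_one_div, div_le_iff₀ ha]
    calc b' * K ≤ (ε * (K * a)) * K := by gcongr; exact hb'.trans (by gcongr)
      _ = K ^ 2 * ε * a := by ring
  have e : Q - Q' = Star.star ((1 - Q') * Q) - (1 - Q) * Q' := by
    rw [star_mul, star_sub, star_one, h.left.isSelfAdjoint.star_eq, h'.left.isSelfAdjoint.star_eq]
    noncomm_ring
  rw [e]
  refine (norm_sub_le _ _).trans ?_
  rw [norm_star]
  linarith

end Gap

/-! ### Cocycles with a uniform gap -/

section GapSystem

variable {𝔄 : Type*} [NormedRing 𝔄] {Y : Type*}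

/-- `prods T g n y = g y * g (T y) * ⋯ * g (T^{n-1} y)`. -/
def prods {G : Type*} [Monoid G] (T : Y → Y) (g : Y → G) : ℕ → Y → G
  | 0, _ => 1
  | n + 1, y => prods T g n y * g (T^[n] y)

theorem prods_add {G : Type*} [Monoid G] (T : Y → Y) (g : Y → G) (m n : ℕ) (y : Y) :
    prods T g (m + n) y = prods T g m y * prods T g n (T^[m] y) := by
  induction n with
  | zero => simp [prods]
  | succ n ih =>
    rw [← add_assoc, prods, ih, prods, mul_assoc, ← Function.iterate_add_apply, add_comm n m]

theorem prods_succ' {G : Type*} [Monoid G] (T : Y → Y) (g : Y → G) (n : ℕ) (y : Y) :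
    prods T g (n + 1) y = g y * prods T g n (T y) := by
  rw [add_comm, prods_add]
  simp [prods]

theorem map_prods {G H : Type*} [Monoid G] [Monoid H] (φ : G →* H) (T : Y → Y) (g : Y → G) (n : ℕ)
    (y : Y) : φ (prods T g n y) = prods T (fun z => φ (g z)) n y := by
  induction n with
  | zero => simp [prods]
  | succ n ih => rw [prods, map_mul, ih, prods]

variable [StarRing 𝔄]

/-- The products of the cocycle have gaps that grow exponentially, in a uniform way. -/
structure GapSystem (T : Y → Y) (g : Y → 𝔄ˣ) (Q S : ℕ → Y → 𝔄) (a b : ℕ → Y → ℝ)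
    (K C θ : ℝ) : Prop where
  one_le : 1 ≤ K
  const_nonneg : 0 ≤ C
  rate_pos : 0 < θ
  rate_lt : θ < 1
  norm_le : ∀ y, ‖(g y : 𝔄)‖ ≤ K
  norm_inv_le : ∀ y, ‖(↑(g y)⁻¹ : 𝔄)‖ ≤ K
  pos : ∀ n y, 0 < a n y
  gap : ∀ n y, Gap (prods T g n y) (Q n y) (S n y) (a n y) (b n y)
  ratio : ∀ n y, b n y ≤ C * θ ^ n * a n y
  right_le : ∀ n y, a n y ≤ K * a (n + 1) y
  right_ge : ∀ n y, a (n + 1) y ≤ K * a n y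
  left_le : ∀ n y, a n (T y) ≤ K * a (n + 1) y
  left_ge : ∀ n y, a (n + 1) y ≤ K * a n (T y)

namespace GapSystem

variable {T : Y → Y} {g : Y → 𝔄ˣ} {Q S : ℕ → Y → 𝔄} {a b : ℕ → Y → ℝ}
  {K C θ : ℝ} (h : GapSystem T g Q S a b K C θ)

include h

theorem ratio_succ (n : ℕ) (y : Y) : b (n + 1) y ≤ C * θ ^ n * a (n + 1) y := by
  refine (h.ratio (n + 1) y).trans ?_
  exact mul_le_mul_of_nonneg_right (mul_le_mul_of_nonneg_left
    (pow_le_pow_of_le_one h.rate_pos.le h.rate_lt.le n.le_succ) h.const_nonneg) (h.pos _ _).le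

variable [CStarRing 𝔄]

theorem norm_left_sub_succ (n : ℕ) (y : Y) :
    ‖Q n y - Q (n + 1) y‖ ≤ 2 * K ^ 2 * (C * θ ^ n) := by
  have h0 := h.const_nonneg
  have h1 := h.rate_pos.le
  exact (h.gap n y).norm_left_sub_le (B := g (T^[n] y)) (h.gap (n + 1) y) (h.pos _ _) (h.pos _ _)
    (by linarith [h.one_le]) (by positivity) (h.norm_le _) (h.norm_inv_le _) (h.ratio n y)
    (h.ratio_succ n y) (h.right_le n y) (h.right_ge n y)

theorem norm_right_sub_succ (n : ℕ) (y : Y) :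
    ‖S n (T y) - S (n + 1) y‖ ≤ 2 * K ^ 2 * (C * θ ^ n) := by
  have h0 := h.const_nonneg
  have h1 := h.rate_pos.le
  have hs := (h.gap (n + 1) y).star
  rw [prods_succ', star_mul] at hs
  refine (h.gap n (T y)).star.norm_left_sub_le (B := star (g y)) hs (h.pos _ _) (h.pos _ _)
    (by linarith [h.one_le]) (by positivity) ?_ ?_ (h.ratio n _)
    (h.ratio_succ n y) (h.left_le n y) (h.left_ge n y)
  · rw [Units.coe_star, norm_star]; exact h.norm_le y
  · rw [Units.coe_star_inv, norm_star]; exact h.norm_inv_le y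

/-- Up to an error of order `θ ^ n`, the right projection of a long product depends only on its last
`n` factors. -/
theorem norm_right_sub (n p : ℕ) (y : Y) :
    ‖S n (T^[p] y) - S (p + n) y‖ ≤ 2 * K ^ 2 * C / (1 - θ) * θ ^ n := by
  have h0 := h.const_nonneg
  have h1 := h.rate_pos.le
  have h2 : 0 < 1 - θ := by linarith [h.rate_lt]
  -- The partial geometric sum is kept so that the induction on `p` closes exactly.
  suffices H : ∀ p y, ‖S n (T^[p] y) - S (p + n) y‖ ≤
      2 * K ^ 2 * C / (1 - θ) * (θ ^ n - θ ^ (p + n)) by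
    refine (H p y).trans ?_
    gcongr
    linarith [pow_nonneg h1 (p + n)]
  clear p y
  intro p
  induction p with
  | zero => intro y; simp
  | succ p ih =>
    intro y
    have e : S n (T^[p + 1] y) - S (p + 1 + n) y =
        (S n (T^[p] (T y)) - S (p + n) (T y)) + (S (p + n) (T y) - S (p + n + 1) y) := by
      rw [Function.iterate_succ_apply, show p + 1 + n = p + n + 1 by ring]; abel
    rw [e]
    refine (norm_add_le _ _).trans ((add_le_add (ih _) (h.norm_right_sub_succ _ _)).trans ?_)
    apply le_of_eq
    field_simp
    ring

theorem exists_limit [CompleteSpace 𝔄] : ∃ P : Y → 𝔄,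
    (∀ y, Tendsto (fun n => Q n y) atTop (𝓝 (P y))) ∧
    (∀ n y, ‖Q n y - P y‖ ≤ 2 * K ^ 2 * C / (1 - θ) * θ ^ n) ∧
    (∀ y, IsStarProjection (P y)) ∧
    ∀ y, (1 - P y) * (g y : 𝔄) * P (T y) = 0 := by
  have h0 := h.const_nonneg
  have h1 := h.rate_pos.le
  have hd : ∀ y n, dist (Q n y) (Q (n + 1) y) ≤ 2 * K ^ 2 * C * θ ^ n := fun y n => by
    rw [dist_eq_norm]
    exact (h.norm_left_sub_succ n y).trans (le_of_eq (by ring))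
  have hc := fun y => cauchySeq_tendsto_of_complete (cauchySeq_of_le_geometric _ _ h.rate_lt (hd y))
  choose P hP using hc
  refine ⟨P, hP, fun n y => ?_, fun y => ⟨?_, ?_⟩, fun y => ?_⟩
  · have := dist_le_of_le_geometric_of_tendsto _ _ h.rate_lt (hd y) (hP y) n
    rw [dist_eq_norm] at this
    exact this.trans (le_of_eq (by ring))
  · refine tendsto_nhds_unique ((hP y).mul (hP y)) ((hP y).congr fun n => ?_)
    exact (h.gap n y).left.isIdempotentElem.symm
  · refine tendsto_nhds_unique (hP y).star ((hP y).congr fun n => ?_)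
    exact (h.gap n y).left.isSelfAdjoint.symm
  · have hl : Tendsto (fun n => (1 - Q (n + 1) y) * (g y : 𝔄) * Q n (T y)) atTop
        (𝓝 ((1 - P y) * (g y : 𝔄) * P (T y))) :=
      (((hP y).comp (tendsto_add_atTop_nat 1)).const_sub 1 |>.mul_const _).mul (hP (T y))
    -- The equivariance defect at finite time is at most `b (n + 1) y / a n (T y)`, which decays
    -- geometrically.
    refine tendsto_nhds_unique hl (squeeze_zero_norm (a := fun n => C * θ ^ n * K) (fun n => ?_) ?_)
    · have hg := h.gap (n + 1) y
      rw [prods_succ'] at hg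
      refine ((h.gap n (T y)).norm_compl_mul_left_shift hg).trans ?_
      rw [mul_one_div, div_le_iff₀ (h.pos _ _)]
      refine (h.ratio_succ n y).trans ?_
      rw [mul_assoc _ K]
      gcongr
      exact h.left_ge n y
    · have := ((tendsto_pow_atTop_nhds_zero_of_lt_one h1 h.rate_lt).const_mul C).mul_const K
      simpa using this

end GapSystem

end GapSystem

end SemigroupAnosov

namespace SemigroupAnosov

open Filter Topology

/-! ### Telescoping and subadditivity: an exponential gain at every scale is impossible. -/

section NearMultiplicative

variable {𝔄 : Type*} [NormedRing 𝔄] {Y : Type*}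

/-- Telescoping estimate for a product along an equivariant family of projections `P`, when the
products are small on the range of `P`, and small modulo the range of `P`. -/
theorem norm_prods_le_sum {T : Y → Y} {g : Y → 𝔄ˣ} {P : Y → 𝔄} {K D θ : ℝ} (hK : 1 ≤ K) (hD : 1 ≤ D)
    (hθ : 0 < θ) (hθ' : θ < 1) (hg : ∀ y, ‖(g y : 𝔄)‖ ≤ K)
    (hP : ∀ y, (1 - P y) * (g y : 𝔄) * P (T y) = 0)
    (hq : ∀ n y, ‖(1 - P y) * (↑(prods T g n y) : 𝔄)‖ ≤ D * θ ^ n * ‖(↑(prods T g n y) : 𝔄)‖)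
    (n : ℕ) (y : Y)
    (hy : ∀ j ≤ n, ‖(↑(prods T g j y) : 𝔄) * P (T^[j] y)‖ ≤ D * θ ^ j * ‖(↑(prods T g j y) : 𝔄)‖) :
    ‖(↑(prods T g n y) : 𝔄)‖ ≤ K * D ^ 2 / θ * θ ^ n * (2 * ‖(↑(prods T g n y) : 𝔄)‖ +
      ∑ k ∈ Finset.range n, ‖(↑(prods T g k y) : 𝔄)‖ * ‖(↑(prods T g (n - 1 - k) (T^[k + 1] y)) : 𝔄)‖) := by
  set A : ℕ → Y → 𝔄 := fun n y => (↑(prods T g n y) : 𝔄) with hA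
  -- `B k` is the full product with the projection inserted after `k` factors. Both end terms are
  -- controlled by `hq` and `hy`: `A n y - B 0` is small modulo `P`, and `B n` is small on `P`.
  set B : ℕ → 𝔄 := fun k => A k y * P (T^[k] y) * A (n - k) (T^[k] y) with hB
  have hdiff : ∀ k < n, ‖B k - B (k + 1)‖ ≤
      K * D ^ 2 / θ * θ ^ n * (‖A k y‖ * ‖A (n - 1 - k) (T^[k + 1] y)‖) := by
    intro k hk
    obtain ⟨m, rfl⟩ : ∃ m, n = k + m + 1 := ⟨n - k - 1, by omega⟩
    have e1 : k + m + 1 - k = m + 1 := by omega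
    have e2 : k + m + 1 - (k + 1) = m := by omega
    have e3 : k + m + 1 - 1 - k = m := by omega
    have eT : T^[k + 1] y = T (T^[k] y) := Function.iterate_succ_apply' T k y
    -- Equivariance cancels everything except a factor small on `P`, one letter, and a factor small
    -- modulo `P`. Their gains `θ ^ k` and `θ ^ m` multiply to `θ ^ n / θ`.
    have e : B k - B (k + 1) = (A k y * P (T^[k] y)) * (g (T^[k] y) : 𝔄) *
        ((1 - P (T^[k + 1] y)) * A m (T^[k + 1] y)) := by
      have hp : ∀ z, (g (T^[k] y) : 𝔄) * (P (T (T^[k] y)) * z) =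
          P (T^[k] y) * ((g (T^[k] y) : 𝔄) * (P (T (T^[k] y)) * z)) := fun z => by
        have := congrArg (· * z) (hP (T^[k] y))
        simpa only [sub_mul, one_mul, zero_mul, sub_eq_zero, mul_assoc] using this
      simp only [hB, hA, e1, e2, eT]
      rw [prods_succ', prods]
      simp only [Units.val_mul, mul_sub, sub_mul, one_mul, mul_assoc]
      rw [← hp]
    rw [e, e3]
    refine (norm_mul_le_of_le_of_le (norm_mul_le_of_le_of_le (hy k (by omega)) (hg _))
      (hq m _)).trans (le_of_eq ?_)
    field_simp
    ring
  have hone : D ≤ K * D ^ 2 / θ := by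
    rw [le_div_iff₀ hθ]
    nlinarith [mul_le_mul hK hD zero_le_one (by linarith)]
  have h0 : A n y = (1 - P y) * A n y + B 0 := by
    simp only [hB, Function.iterate_zero, id, Nat.sub_zero]
    simp [hA, prods, sub_mul]
  have hn : ‖B n‖ ≤ K * D ^ 2 / θ * θ ^ n * ‖A n y‖ := by
    have : B n = A n y * P (T^[n] y) := by simp [hB, hA, prods]
    rw [this]
    exact (hy n le_rfl).trans (by gcongr)
  have hsum : ‖B 0 - B n‖ ≤ ∑ k ∈ Finset.range n,
      K * D ^ 2 / θ * θ ^ n * (‖A k y‖ * ‖A (n - 1 - k) (T^[k + 1] y)‖) := by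
    rw [← Finset.sum_range_sub']
    exact norm_sum_le_of_le _ fun k hk => hdiff k (Finset.mem_range.1 hk)
  rw [← Finset.mul_sum] at hsum
  have hq' : ‖(1 - P y) * A n y‖ ≤ K * D ^ 2 / θ * θ ^ n * ‖A n y‖ :=
    (hq n y).trans (by gcongr)
  have e : A n y = (1 - P y) * A n y + ((B 0 - B n) + B n) := by rw [sub_add_cancel, ← h0]
  calc ‖A n y‖ = ‖(1 - P y) * A n y + ((B 0 - B n) + B n)‖ := by rw [← e]
    _ ≤ ‖(1 - P y) * A n y‖ + (‖B 0 - B n‖ + ‖B n‖) :=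
      (norm_add_le _ _).trans (add_le_add le_rfl (norm_add_le _ _))
    _ ≤ _ := by linarith

/-- A subadditive sequence cannot be improved at all scales by an exponential factor. -/
theorem _root_.Subadditive.not_forall_exp_le {M : ℕ → ℝ} (hM : Subadditive M) {κ B θ : ℝ}
    (hκ : ∀ n : ℕ, -(n * κ) ≤ M n) (hB : 0 < B) (hθ : 0 < θ) (hθ' : θ < 1) :
    ¬ ∀ n, Real.exp (M n) ≤ B * θ ^ n * (2 * Real.exp (M n + 1) +
      ∑ k ∈ Finset.range n, Real.exp (M k + 1) * Real.exp (M (n - 1 - k) + 1)) := by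
  intro H
  have hbdd : BddBelow (Set.range fun n => M n / n) := by
    refine ⟨-|κ|, ?_⟩
    rintro _ ⟨n, rfl⟩
    rcases Nat.eq_zero_or_pos n with rfl | hn
    · simp
    · have hn' : (0 : ℝ) < n := by exact_mod_cast hn
      simp only
      rw [le_div_iff₀ hn']
      nlinarith [hκ n, le_abs_self κ]
  set l := hM.lim with hl
  -- With `θ = exp (-2η)`, half of the gain pays for the error in `M n ≤ n (l + η) + E`, and the
  -- other half still beats the `n + 2` terms.
  set η : ℝ := -Real.log θ / 2 with hη
  have hη0 : 0 < η := by
    have := Real.log_neg hθ hθ'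
    rw [hη]; linarith
  have hθη : θ = Real.exp (-(2 * η)) := by
    rw [hη, show -(2 * (-Real.log θ / 2)) = Real.log θ by ring, Real.exp_log hθ]
  obtain ⟨E, hE0, hE⟩ : ∃ E : ℝ, 0 ≤ E ∧ ∀ n : ℕ, M n ≤ n * (l + η) + E := by
    have h1 : ∀ᶠ n : ℕ in atTop, M n / n < l + η :=
      (hM.tendsto_lim hbdd).eventually (gt_mem_nhds (by linarith))
    obtain ⟨N, hN⟩ := eventually_atTop.1 h1
    have hnn : ∀ n ∈ Finset.range (N + 1), 0 ≤ |M n - n * (l + η)| := fun n _ => abs_nonneg _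
    refine ⟨∑ n ∈ Finset.range (N + 1), |M n - n * (l + η)|, Finset.sum_nonneg hnn, fun n => ?_⟩
    rcases lt_or_ge n (N + 1) with h | h
    · have := Finset.single_le_sum hnn (Finset.mem_range.2 h)
      linarith [le_abs_self (M n - n * (l + η))]
    · have hn' : (0 : ℝ) < n := by exact_mod_cast (by omega : 0 < n)
      have := hN n (by omega)
      rw [div_lt_iff₀ hn'] at this
      linarith [Finset.sum_nonneg hnn]
  -- Two factors cost `2 * E` and two increments `+ 1`; the absolute value accounts for the lengths
  -- `k` and `n - 1 - k` adding up to `n - 1` only.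
  set F : ℝ := 2 * E + 2 + |l + η| with hF
  have hbound : ∀ n : ℕ, 1 ≤ n → 1 ≤ B * Real.exp F * ((n + 2) * Real.exp (-η) ^ n) := by
    intro n hn
    have hn' : (0 : ℝ) < n := by exact_mod_cast hn
    have hlow : n * l ≤ M n := by
      have := hM.lim_le_div hbdd (n := n) (by omega)
      rw [le_div_iff₀ hn'] at this
      linarith
    have hterm : ∀ k ∈ Finset.range n, Real.exp (M k + 1) * Real.exp (M (n - 1 - k) + 1) ≤
        Real.exp (n * (l + η) + F) := by
      intro k hk
      have hk' := Finset.mem_range.1 hk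
      rw [← Real.exp_add, Real.exp_le_exp]
      have h1 := hE k
      have h2 := hE (n - 1 - k)
      have h3 : ((n - 1 - k : ℕ) : ℝ) = n - 1 - k := by
        rw [Nat.cast_sub (by omega), Nat.cast_sub hn]; simp
      rw [h3] at h2
      have := neg_abs_le (l + η)
      rw [hF]; linarith
    have hfirst : Real.exp (M n + 1) ≤ Real.exp (n * (l + η) + F) := by
      rw [Real.exp_le_exp]
      have := abs_nonneg (l + η)
      rw [hF]; linarith [hE n]
    have h4 : Real.exp (n * l) ≤ B * θ ^ n * ((n + 2) * Real.exp (n * (l + η) + F)) := by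
      refine (Real.exp_le_exp.2 hlow).trans ((H n).trans ?_)
      gcongr
      have := Finset.sum_le_sum hterm
      rw [Finset.sum_const, Finset.card_range, nsmul_eq_mul] at this
      linarith
    rw [hθη, ← Real.exp_nat_mul] at h4
    rw [← Real.exp_nat_mul]
    have e : B * Real.exp (n * -(2 * η)) * ((n + 2) * Real.exp (n * (l + η) + F)) =
        (B * Real.exp F * ((n + 2) * Real.exp (n * -η))) * Real.exp (n * l) := by
      have : Real.exp (n * -(2 * η)) * Real.exp (n * (l + η) + F) =
          Real.exp F * Real.exp (n * -η) * Real.exp (n * l) := by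
        simp only [← Real.exp_add]; congr 1; ring
      linear_combination B * (n + 2) * this
    rw [e] at h4
    exact le_of_mul_le_mul_right (by linarith) (Real.exp_pos (n * l))
  have ht : Tendsto (fun n : ℕ => B * Real.exp F * (((n : ℝ) + 2) * Real.exp (-η) ^ n)) atTop
      (𝓝 0) := by
    have hr0 := (Real.exp_pos (-η)).le
    have hr : Real.exp (-η) < 1 := Real.exp_lt_one_iff.2 (by linarith)
    have h1 := tendsto_self_mul_const_pow_of_lt_one hr0 hr
    have h2 := (tendsto_pow_atTop_nhds_zero_of_lt_one hr0 hr).const_mul 2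
    have := (h1.add h2).const_mul (B * Real.exp F)
    simpa [add_mul] using this
  obtain ⟨n, hn1, hn2⟩ := ((ht.eventually (gt_mem_nhds one_pos)).and (eventually_ge_atTop 1)).exists
  linarith [hbound n hn2]

end NearMultiplicative

/-! ### Uniform transversality of the limit projections to the kernels of the right projections. -/

namespace GapSystem

variable {𝔄 : Type*} [NormedRing 𝔄] [StarRing 𝔄] [CStarRing 𝔄] {Y : Type*}
  {T : Y → Y} {g : Y → 𝔄ˣ} {Q S : ℕ → Y → 𝔄} {a b : ℕ → Y → ℝ}
  {K C θ : ℝ} (h : GapSystem T g Q S a b K C θ)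

-- Near a failure, the norm of a product is not seen on `P` at its end. The right projections
-- remember only recent letters, so this passes to short products ending at the same place. These
-- are then small both on `P` and modulo `P`, at every scale, which subadditivity forbids.
include h in
theorem exists_norm_prods_mul_ge (hnorm : ∀ n y, a n y = ‖(↑(prods T g n y) : 𝔄)‖) {P : Y → 𝔄} {D : ℝ}
    (hPQ : ∀ n y, ‖Q n y - P y‖ ≤ D * θ ^ n)
    (hproj : ∀ y, IsStarProjection (P y)) (hP : ∀ y, (1 - P y) * (g y : 𝔄) * P (T y) = 0) :
    ∃ c > 0, ∀ n y, c * ‖(↑(prods T g n y) : 𝔄)‖ ≤ ‖(↑(prods T g n y) : 𝔄) * P (T^[n] y)‖ := by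
  by_contra! hcon
  set A : ℕ → Y → 𝔄 := fun n y => (↑(prods T g n y) : 𝔄) with hA
  have hApos : ∀ n y, 0 < ‖A n y‖ := fun n y => hnorm n y ▸ h.pos n y
  have hK := h.one_le
  have hK0 : 0 < K := by linarith
  set τ : ℕ × Y → ℝ := fun z => ‖A z.1 z.2 * P (T^[z.1] z.2)‖ / ‖A z.1 z.2‖ with hτ
  have hτ0 : ∀ z, 0 ≤ τ z := fun z => div_nonneg (norm_nonneg _) (norm_nonneg _)
  -- The filter replaces a limit point: it consists of the times and points where the bound fails
  -- more and more. It is nontrivial by the contradiction hypothesis.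
  set F : Filter (ℕ × Y) := comap τ (𝓝 0) with hF
  have hFτ : Tendsto τ F (𝓝 0) := tendsto_comap
  have hne : F.NeBot := by
    refine comap_neBot fun t ht => ?_
    obtain ⟨ε, hε, hball⟩ := Metric.mem_nhds_iff.1 ht
    obtain ⟨n, y, hny⟩ := hcon ε hε
    refine ⟨(n, y), hball ?_⟩
    rw [Metric.mem_ball, dist_zero_right, Real.norm_of_nonneg (hτ0 _)]
    exact (div_lt_iff₀ (hApos n y)).2 hny
  set s : ℕ × Y → ℕ × Y := fun z => (z.1 + 1, z.2) with hs
  -- One more letter multiplies `τ` by at most `K ^ 2`, so the filter is preserved by the passage to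
  -- the next time, and by finitely many such passages.
  have hτs : ∀ z, τ (s z) ≤ K ^ 2 * τ z := by
    rintro ⟨p, x⟩
    simp only [hτ, hs]
    rw [div_le_iff₀ (hApos _ _)]
    have h1 : ‖A (p + 1) x * P (T^[p + 1] x)‖ ≤ ‖A p x * P (T^[p] x)‖ * K := by
      have e : A (p + 1) x * P (T^[p + 1] x) =
          A p x * P (T^[p] x) * ((g (T^[p] x) : 𝔄) * P (T^[p + 1] x)) := by
        have := hP (T^[p] x)
        rw [sub_mul, one_mul, sub_mul, sub_eq_zero] at this
        simp only [hA, prods, Units.val_mul, Function.iterate_succ_apply' T p x, mul_assoc] at this ⊢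
        rw [← this]
      rw [e]
      refine norm_mul_le_of_le_of_le le_rfl ?_
      simpa using norm_mul_le_of_le_of_le (h.norm_le (T^[p] x)) (hproj (T^[p + 1] x)).norm_le
    have h2 : ‖A p x‖ ≤ K * ‖A (p + 1) x‖ := by
      have := h.right_le p x
      rwa [hnorm, hnorm] at this
    refine h1.trans ?_
    have h3 : ‖A p x * P (T^[p] x)‖ = ‖A p x * P (T^[p] x)‖ / ‖A p x‖ * ‖A p x‖ :=
      (div_mul_cancel₀ _ (hApos p x).ne').symm
    calc _ = ‖A p x * P (T^[p] x)‖ / ‖A p x‖ * ‖A p x‖ * K := by rw [← h3]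
      _ ≤ ‖A p x * P (T^[p] x)‖ / ‖A p x‖ * (K * ‖A (p + 1) x‖) * K := by gcongr
      _ = _ := by ring
  have hsF : Tendsto s F F := by
    rw [hF, tendsto_comap_iff]
    refine squeeze_zero (fun z => hτ0 _) hτs ?_
    simpa using hFτ.const_mul (K ^ 2)
  have hsit : ∀ j z, s^[j] z = (z.1 + j, z.2) := by
    intro j z
    induction j with
    | zero => simp
    | succ j ih => rw [Function.iterate_succ_apply', ih]; rfl
  have hsFj : ∀ j, Tendsto (s^[j]) F F := fun j => hsF.iterate j
  -- Products of length `n` that start at the time recorded in `z`, after the long product whose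
  -- ratio is `τ z`.
  set u : ℕ → ℕ × Y → ℝ := fun n z => Real.log ‖A n (T^[z.1] z.2)‖ with hu
  obtain ⟨κ, hκ⟩ : ∃ κ : ℝ, ∀ n z, |u n z| ≤ n * κ := by
    refine ⟨Real.log K, fun n z => ?_⟩
    simp only [hu]
    generalize T^[z.1] z.2 = y
    induction n with
    | zero =>
      have : Nontrivial 𝔄 := ⟨1, 0, fun h1 => by
        have := hApos 0 z.2
        simp [hA, prods, h1] at this⟩
      simp [hA, prods]
    | succ n ih =>
      have h1 := h.right_le n y
      have h2 := h.right_ge n y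
      rw [hnorm, hnorm] at h1 h2
      have h3 := Real.log_le_log (hApos n y) h1
      have h4 := Real.log_le_log (hApos (n + 1) y) h2
      rw [Real.log_mul hK0.ne' (hApos _ _).ne'] at h3 h4
      rw [abs_le] at ih ⊢
      push_cast
      constructor <;> linarith
  have hub : ∀ n, F.IsBoundedUnder (· ≤ ·) (u n) := fun n =>
    isBoundedUnder_of ⟨n * κ, fun z => (abs_le.1 (hκ n z)).2⟩
  have hub' : ∀ n, F.IsBoundedUnder (· ≥ ·) (u n) := fun n =>
    isBoundedUnder_of ⟨-(n * κ), fun z => (abs_le.1 (hκ n z)).1⟩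
  set M : ℕ → ℝ := fun n => limsup (u n) F with hM
  have hMlt : ∀ n j {δ : ℝ}, 0 < δ → ∀ᶠ z in F, u n (s^[j] z) < M n + δ := fun n j δ hδ =>
    (hsFj j).eventually (eventually_lt_of_limsup_lt (by simp only [hM]; linarith) (hub n))
  have hMle : ∀ n {m : ℝ}, (∀ᶠ z in F, u n z ≤ m) → M n ≤ m := fun n m hm =>
    limsup_le_of_le (hub' n).isCoboundedUnder_le hm
  have hiter : ∀ j z, T^[(s^[j] z).1] (s^[j] z).2 = T^[j] (T^[z.1] z.2) := fun j z => by
    rw [hsit, ← Function.iterate_add_apply, add_comm]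
  have hsub : Subadditive M := by
    intro m n
    refine le_of_forall_pos_le_add fun δ hδ => hMle _ ?_
    filter_upwards [hMlt m 0 (half_pos hδ), hMlt n m (half_pos hδ)] with z h1 h2
    have h3 : u (m + n) z ≤ u m z + u n (s^[m] z) := by
      simp only [hu, hiter]
      rw [← Real.log_mul (hApos _ _).ne' (hApos _ _).ne']
      refine Real.log_le_log (hApos _ _) ?_
      simp only [hA]
      rw [prods_add, Units.val_mul]
      exact norm_mul_le _ _
    simp only [Function.iterate_zero, id] at h1
    linarith
  have hMlow : ∀ n : ℕ, -(n * κ) ≤ M n := fun n =>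
    le_limsup_of_le (hub n) fun b hb => by
      obtain ⟨z, hz⟩ := hb.exists
      exact (abs_le.1 (hκ n z)).1.trans hz
  obtain ⟨D', hD'1, hq, hr⟩ : ∃ D' : ℝ, 1 ≤ D' ∧
      (∀ n y, ‖(1 - P y) * A n y‖ ≤ D' * θ ^ n * ‖A n y‖) ∧
      ∀ j p x, ‖A j (T^[p] x) * P (T^[j] (T^[p] x))‖ ≤
        (τ (p + j, x) + D' / 2 * θ ^ j) * ‖A j (T^[p] x)‖ := by
    have h0 := h.const_nonneg
    have h1 := h.rate_pos.le
    set D₂ : ℝ := 2 * K ^ 2 * C / (1 - θ) with hD₂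
    have hD₂0 : 0 ≤ D₂ := div_nonneg (by positivity) (by linarith [h.rate_lt])
    have hbA : ∀ n y, b n y ≤ C * θ ^ n * ‖A n y‖ := fun n y => by
      have := h.ratio n y
      rwa [hnorm] at this
    -- The factor `2` leaves half of `D'` free in the third bound, to absorb `τ` once it is at most
    -- `D' / 2 * θ ^ n`.
    refine ⟨2 * (C + |D| + D₂) + 1, by linarith [abs_nonneg D], fun n y => ?_, fun j p x => ?_⟩
    · have e : (1 - P y) * A n y = (1 - Q n y) * A n y + (Q n y - P y) * A n y := by noncomm_ring
      rw [e]
      have h2 : ‖(1 - Q n y) * A n y‖ ≤ C * θ ^ n * ‖A n y‖ := by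
        rw [(h.gap n y).upper_comm]
        exact (h.gap n y).upper.trans (hbA n y)
      have h3 : ‖(Q n y - P y) * A n y‖ ≤ |D| * θ ^ n * ‖A n y‖ :=
        norm_mul_le_of_le_of_le ((hPQ n y).trans (by gcongr; exact le_abs_self D)) le_rfl
      refine (norm_add_le _ _).trans ((add_le_add h2 h3).trans ?_)
      rw [← add_mul, ← add_mul]
      refine mul_le_mul_of_nonneg_right (mul_le_mul_of_nonneg_right ?_ (pow_nonneg h1 n))
        (norm_nonneg _)
      linarith [abs_nonneg D]
    · have ep : T^[j] (T^[p] x) = T^[p + j] x := by rw [← Function.iterate_add_apply, add_comm]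
      set y := T^[p] x with hy
      rw [ep]
      have hPn := (hproj (T^[p + j] x)).norm_le
      -- The long product is inverted on its strong part at the cost of one over its norm; smallness
      -- of `τ` thus puts `P` close to the kernel of its right projection.
      have h2 : ‖S (p + j) x * P (T^[p + j] x)‖ ≤ τ (p + j, x) := by
        have e : S (p + j) x * P (T^[p + j] x) = (S (p + j) x * (↑(prods T g (p + j) x)⁻¹ : 𝔄)) *
            (A (p + j) x * P (T^[p + j] x)) := by
          simp only [hA, mul_assoc, Units.inv_mul_cancel_left]
        rw [e]
        refine (norm_mul_le_of_le_of_le (h.gap (p + j) x).lower le_rfl).trans (le_of_eq ?_)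
        rw [hnorm, one_div_mul_eq_div]
      have h3 : ‖S j y * P (T^[p + j] x)‖ ≤ τ (p + j, x) + D₂ * θ ^ j := by
        have e : S j y * P (T^[p + j] x) = S (p + j) x * P (T^[p + j] x) +
            (S j y - S (p + j) x) * P (T^[p + j] x) := by noncomm_ring
        rw [e]
        refine (norm_add_le _ _).trans (add_le_add h2 ?_)
        simpa using norm_mul_le_of_le_of_le (h.norm_right_sub j p x) hPn
      have e : A j y * P (T^[p + j] x) = A j y * (1 - S j y) * P (T^[p + j] x) +
          A j y * (S j y * P (T^[p + j] x)) := by noncomm_ring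
      rw [e]
      have h4 := norm_mul_le_of_le_of_le ((h.gap j y).upper.trans (hbA j y)) hPn
      have h5 := norm_mul_le_of_le_of_le (le_refl ‖A j y‖) h3
      refine (norm_add_le _ _).trans ((add_le_add h4 h5).trans ?_)
      have : 0 ≤ θ ^ j * ‖A j y‖ := by positivity
      nlinarith [mul_nonneg (abs_nonneg D) this]
  refine hsub.not_forall_exp_le hMlow (B := K * D' ^ 2 / θ)
    (by have := h.rate_pos; positivity) h.rate_pos h.rate_lt fun n => ?_
  have hRpos : 0 < K * D' ^ 2 / θ * θ ^ n * (2 * Real.exp (M n + 1) +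
      ∑ k ∈ Finset.range n, Real.exp (M k + 1) * Real.exp (M (n - 1 - k) + 1)) := by
    have := h.rate_pos
    positivity
  rw [← Real.le_log_iff_exp_le hRpos]
  refine hMle n ?_
  -- Here `n` is fixed, so finitely many conditions have to hold eventually, and `θ ^ n ≤ θ ^ j`
  -- serves all prefixes of length `j ≤ n`.
  have hsmall : ∀ᶠ z in F, ∀ j ∈ Finset.range (n + 1), τ (s^[j] z) ≤ D' / 2 * θ ^ n := by
    rw [Filter.eventually_all_finset]
    intro j _
    have := h.rate_pos
    exact (hFτ.comp (hsFj j)).eventually_le_const (by positivity)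
  have hgrow : ∀ᶠ z in F, ∀ j ∈ Finset.range (n + 1), ∀ k ∈ Finset.range (n + 1),
      u k (s^[j] z) < M k + 1 := by
    simp only [Filter.eventually_all_finset]
    intro j _ k _
    exact hMlt k j one_pos
  filter_upwards [hsmall, hgrow] with z hz1 hz2
  have hexp : ∀ j ≤ n, ∀ k ≤ n, ‖A k (T^[j] (T^[z.1] z.2))‖ ≤ Real.exp (M k + 1) := by
    intro j hj k hk
    have := hz2 j (Finset.mem_range.2 (by omega)) k (Finset.mem_range.2 (by omega))
    simp only [hu, hiter] at this
    exact (Real.log_le_iff_le_exp (hApos _ _)).1 this.le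
  have := h.rate_pos
  refine Real.log_le_log (hApos _ _) ((norm_prods_le_sum hK hD'1 h.rate_pos h.rate_lt h.norm_le hP hq n
    (T^[z.1] z.2) fun j hj => ?_).trans ?_)
  · refine (hr j z.1 z.2).trans (mul_le_mul_of_nonneg_right ?_ (norm_nonneg _))
    have h1 := hz1 j (Finset.mem_range.2 (by omega))
    rw [hsit] at h1
    have h2 : θ ^ n ≤ θ ^ j := pow_le_pow_of_le_one h.rate_pos.le h.rate_lt.le hj
    nlinarith
  · gcongr with k hk
    · exact hexp 0 (by omega) n le_rfl
    · exact hexp 0 (by omega) k (Finset.mem_range.1 hk).le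
    · exact hexp (k + 1) (Finset.mem_range.1 hk) (n - 1 - k) (by omega)

-- The weak part of the product is negligible for large `n`, so the lower bound on `P (T^[n] y)`
-- must come through `S n y`; then `P` is replaced by its approximation `Q m`.
include h in
theorem exists_norm_right_mul_left_ge [CompleteSpace 𝔄]
    (hnorm : ∀ n y, a n y = ‖(↑(prods T g n y) : 𝔄)‖) :
    ∃ c > 0, ∃ N, ∀ n ≥ N, ∀ m ≥ N, ∀ y, c ≤ ‖S n y * Q m (T^[n] y)‖ := by
  obtain ⟨P, -, hPQ, hproj, hP⟩ := h.exists_limit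
  obtain ⟨c, hc, H⟩ := h.exists_norm_prods_mul_ge hnorm hPQ hproj hP
  have hlim : ∀ E : ℝ, ∀ᶠ n : ℕ in atTop, E * θ ^ n < c / 4 := fun E => by
    have := (tendsto_pow_atTop_nhds_zero_of_lt_one h.rate_pos.le h.rate_lt).const_mul E
    rw [mul_zero] at this
    exact this.eventually (gt_mem_nhds (by linarith))
  obtain ⟨N, hN⟩ := eventually_atTop.1 ((hlim C).and (hlim (2 * K ^ 2 * C / (1 - θ))))
  refine ⟨c / 2, half_pos hc, N, fun n hn m hm y => ?_⟩
  have hA : 0 < ‖(↑(prods T g n y) : 𝔄)‖ := hnorm n y ▸ h.pos n y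
  set A : 𝔄 := ↑(prods T g n y)
  have e : A * P (T^[n] y) = A * (1 - S n y) * P (T^[n] y) + A * (S n y * P (T^[n] y)) := by
    noncomm_ring
  have h1 : ‖A * (1 - S n y) * P (T^[n] y)‖ ≤ C * θ ^ n * ‖A‖ * 1 :=
    norm_mul_le_of_le_of_le ((h.gap n y).upper.trans (hnorm n y ▸ h.ratio n y)) (hproj _).norm_le
  have h2 : ‖A * (S n y * P (T^[n] y))‖ ≤ ‖A‖ * ‖S n y * P (T^[n] y)‖ := norm_mul_le _ _
  have h3 : c * ‖A‖ ≤ (C * θ ^ n + ‖S n y * P (T^[n] y)‖) * ‖A‖ := by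
    refine (H n y).trans ?_
    rw [e]
    refine (norm_add_le _ _).trans ?_
    linarith
  have h4 := le_of_mul_le_mul_right h3 hA
  have h5 : ‖S n y * (P (T^[n] y) - Q m (T^[n] y))‖ ≤ 1 * (2 * K ^ 2 * C / (1 - θ) * θ ^ m) :=
    norm_mul_le_of_le_of_le (h.gap n y).right.norm_le (by rw [norm_sub_rev]; exact hPQ m _)
  rw [mul_sub] at h5
  have h6 := norm_sub_norm_le (S n y * P (T^[n] y)) (S n y * Q m (T^[n] y))
  linarith [(hN n hn).1, (hN m hm).2]

end GapSystem

end SemigroupAnosov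

noncomputable section

namespace SemigroupAnosov

open Filter Topology Matrix

/-! ### Singular value decompositions -/

section SVD

variable {d : ℕ}

theorem exists_transpose_mul_self_eq (A : Matrix (Fin d) (Fin d) ℝ) :
    ∃ V ∈ orthogonalGroup (Fin d) ℝ,
      Aᵀ * A = star V * diagonal (fun j : Fin d => (act A).singularValues j ^ 2) * V := by
  have hn : Module.finrank ℝ (Euc d) = d := by simp
  set e := (act A).isSymmetric_adjoint_comp_self.eigenvectorBasis hn with he
  set V : Matrix (Fin d) (Fin d) ℝ := Matrix.of fun j l => e j l with hV
  have hVV : V * star V = 1 := by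
    ext j l
    have := orthonormal_iff_ite.1 e.orthonormal l j
    rw [Matrix.mul_apply, one_apply]
    simp only [PiLp.inner_apply, RCLike.inner_apply, conj_trivial] at this
    simp only [star_apply, star_trivial, hV, of_apply, eq_comm (a := j)]
    exact this
  have hVV' : star V * V = 1 := mul_eq_one_comm.1 hVV
  refine ⟨V, (mem_orthogonalGroup_iff _ _).2 hVV, ?_⟩
  have key : Aᵀ * A * star V = star V * diagonal (fun j : Fin d => (act A).singularValues j ^ 2) := by
    ext l j
    have h1 := (act A).isSymmetric_adjoint_comp_self.apply_eigenvectorBasis hn j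
    rw [← LinearMap.sq_singularValues_fin] at h1
    have h2 : (act A).adjoint ∘ₗ act A = toEuclideanLin (Aᵀ * A) := by
      rw [act, ← toEuclideanLin_conjTranspose_eq_adjoint, conjTranspose_eq_transpose_of_trivial]
      ext x i
      simp [toLpLin_apply]
    rw [← he, h2] at h1
    have h3 := congrArg (fun v : Euc d => v l) h1
    simp only [toLpLin_apply, PiLp.smul_apply, smul_eq_mul, RCLike.ofReal_real_eq_id, id] at h3
    rw [mul_diagonal, Matrix.mul_apply]
    simp only [star_apply, star_trivial, hV, of_apply]
    rw [mul_comm (e j l)]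
    exact h3
  rw [← key, mul_assoc, hVV', mul_one]

theorem exists_svd (g : GL (Fin d) ℝ) :
    ∃ U ∈ orthogonalGroup (Fin d) ℝ, ∃ V ∈ orthogonalGroup (Fin d) ℝ,
      (g : Matrix (Fin d) (Fin d) ℝ) =
        U * diagonal (fun j : Fin d => (act (g : Matrix (Fin d) (Fin d) ℝ)).singularValues j) * V := by
  set A : Matrix (Fin d) (Fin d) ℝ := g.val
  obtain ⟨V, hV, hAV⟩ := exists_transpose_mul_self_eq A
  have hVV : V * star V = 1 := (mem_orthogonalGroup_iff _ _).1 hV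
  have hVV' : star V * V = 1 := (mem_orthogonalGroup_iff' _ _).1 hV
  set s : Fin d → ℝ := fun j => (act A).singularValues j
  have hs : ∀ j, s j ≠ 0 := fun j => by
    have hinj : Function.Injective (act A) := by
      refine Function.LeftInverse.injective (g := act (↑g⁻¹ : Matrix (Fin d) (Fin d) ℝ)) fun x => ?_
      simp [act, toLpLin_apply, A]
    exact ((act A).injective_iff_forall_lt_finrank_singularValues_pos.1 hinj j (by simp)).ne'
  have hD : diagonal s * diagonal s⁻¹ = 1 := by simp [diagonal_mul_diagonal, hs]
  have hD' : diagonal s⁻¹ * diagonal s = 1 := by simp [diagonal_mul_diagonal, hs]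
  have hDD : diagonal (fun j : Fin d => (act A).singularValues j ^ 2) = diagonal s * diagonal s := by
    simp [diagonal_mul_diagonal, s, sq]
  rw [hDD] at hAV
  refine ⟨A * star V * diagonal s⁻¹, ?_, V, hV, ?_⟩
  · rw [mem_orthogonalGroup_iff']
    have e1 : star (A * star V * diagonal s⁻¹) = diagonal s⁻¹ * V * Aᵀ := by
      simp [star_eq_conjTranspose, mul_assoc]
    calc star (A * star V * diagonal s⁻¹) * (A * star V * diagonal s⁻¹)
        = diagonal s⁻¹ * V * (Aᵀ * A) * star V * diagonal s⁻¹ := by rw [e1]; simp only [mul_assoc]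
      _ = diagonal s⁻¹ * (V * star V) * diagonal s * (diagonal s * (V * star V) * diagonal s⁻¹) := by
        rw [hAV]; simp only [mul_assoc]
      _ = 1 := by rw [hVV, mul_one, mul_one, hD', hD, one_mul]
  · rw [mul_assoc (A * star V), hD', mul_one, mul_assoc, hVV', mul_one]

end SVD

/-! ### Exterior powers -/

section Alt

variable {k d : ℕ}

/-- The `k`-th Kronecker power of a matrix. -/
def kron (k : ℕ) (A : Matrix (Fin d) (Fin d) ℝ) : Matrix (Fin k → Fin d) (Fin k → Fin d) ℝ :=
  Matrix.of fun φ χ => ∏ j, A (φ j) (χ j)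

theorem kron_mul (A B : Matrix (Fin d) (Fin d) ℝ) : kron k (A * B) = kron k A * kron k B := by
  ext φ χ
  simp only [kron, of_apply, Matrix.mul_apply, Finset.prod_univ_sum, Fintype.piFinset_univ,
    Finset.prod_mul_distrib]

theorem kron_transpose (A : Matrix (Fin d) (Fin d) ℝ) : kron k Aᵀ = (kron k A)ᵀ := rfl

theorem kron_diagonal (s : Fin d → ℝ) :
    kron k (diagonal s) = diagonal fun φ : Fin k → Fin d => ∏ j, s (φ j) := by
  ext φ χ
  simp only [kron, of_apply, diagonal_apply, Finset.prod_ite_zero]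
  simp [funext_iff]

/-- The alternating tensors, as a model of the `k`-th exterior power of `ℝ^d`. -/
def Alt (k d : ℕ) : Submodule ℝ (EuclideanSpace ℝ (Fin k → Fin d)) where
  carrier := {t | ∀ (σ : Equiv.Perm (Fin k)) (φ : Fin k → Fin d),
    t (φ ∘ σ) = (Equiv.Perm.sign σ : ℝ) * t φ}
  add_mem' {t u} ht hu σ φ := by simp [ht σ φ, hu σ φ, mul_add]
  zero_mem' := by simp
  smul_mem' c t ht σ φ := by simp [ht σ φ, mul_left_comm]

theorem Alt.apply_eq_zero {t : EuclideanSpace ℝ (Fin k → Fin d)} (ht : t ∈ Alt k d)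
    {φ : Fin k → Fin d} (hφ : ¬ Function.Injective φ) : t φ = 0 := by
  simp only [Function.Injective, not_forall] at hφ
  obtain ⟨x, y, hxy, hne⟩ := hφ
  have h := ht (Equiv.swap x y) φ
  have e : φ ∘ Equiv.swap x y = φ := by
    ext z
    simp only [Function.comp_apply, Equiv.swap_apply_def]
    split_ifs with h1 h2
    · rw [h1, hxy]
    · rw [h2, hxy]
    · rfl
  rw [e, Equiv.Perm.sign_swap hne] at h
  push_cast at h
  linarith

theorem kron_mem_Alt (A : Matrix (Fin d) (Fin d) ℝ) :
    ∀ t ∈ Alt k d, toEuclideanLin (kron k A) t ∈ Alt k d := by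
  intro t ht σ φ
  simp only [toLpLin_apply, mulVec, dotProduct, kron, of_apply]
  rw [Finset.mul_sum, ← (Equiv.arrowCongr σ.symm (Equiv.refl (Fin d))).sum_comp]
  refine Finset.sum_congr rfl fun χ _ => ?_
  have e : (Equiv.arrowCongr σ.symm (Equiv.refl (Fin d))) χ = χ ∘ σ := by ext; simp
  rw [e, ht σ χ]
  simp only [Function.comp_apply]
  rw [Equiv.prod_comp σ fun j => A (φ j) (χ j)]
  ring

/-- The Euclidean space of alternating tensors. -/
def AltSpace (k d : ℕ) : Type := Alt k d

instance : NormedAddCommGroup (AltSpace k d) := inferInstanceAs (NormedAddCommGroup (Alt k d))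

instance : InnerProductSpace ℝ (AltSpace k d) := inferInstanceAs (InnerProductSpace ℝ (Alt k d))

instance : FiniteDimensional ℝ (AltSpace k d) := inferInstanceAs (FiniteDimensional ℝ (Alt k d))

instance : CompleteSpace (AltSpace k d) := FiniteDimensional.complete ℝ _

/-- The algebra of operators on the `k`-th exterior power of `ℝ^d`. -/
abbrev AltOp (k d : ℕ) : Type := AltSpace k d →L[ℝ] AltSpace k d

/-- The action of matrices on the exterior power. -/
def altHom (k d : ℕ) : Matrix (Fin d) (Fin d) ℝ →* AltOp k d where
  toFun A := LinearMap.toContinuousLinearMap (E := AltSpace k d) (F' := AltSpace k d)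
    ((toEuclideanLin (kron k A)).restrict (kron_mem_Alt A))
  map_one' := by
    have : kron k (1 : Matrix (Fin d) (Fin d) ℝ) = 1 := by
      rw [← diagonal_one, kron_diagonal]; simp
    refine ContinuousLinearMap.ext fun t => Subtype.ext ?_
    change toEuclideanLin (kron k 1) t.1 = t.1
    simp [this]
  map_mul' A B := by
    refine ContinuousLinearMap.ext fun t => Subtype.ext ?_
    change toEuclideanLin (kron k (A * B)) t.1 =
      toEuclideanLin (kron k A) (toEuclideanLin (kron k B) t.1)
    simp [kron_mul, toLpLin_apply]

theorem altHom_apply (A : Matrix (Fin d) (Fin d) ℝ) (t : AltSpace k d) :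
    (altHom k d A t).1 = toEuclideanLin (kron k A) t.1 := rfl

theorem AltSpace.norm_eq (t : AltSpace k d) : ‖t‖ = ‖t.1‖ := rfl

theorem AltSpace.inner_eq (t u : AltSpace k d) : inner ℝ t u = inner ℝ t.1 u.1 := rfl

theorem altHom_star (A : Matrix (Fin d) (Fin d) ℝ) : altHom k d (star A) = star (altHom k d A) := by
  rw [ContinuousLinearMap.star_eq_adjoint, ContinuousLinearMap.eq_adjoint_iff]
  intro x y
  rw [AltSpace.inner_eq, AltSpace.inner_eq, altHom_apply, altHom_apply, star_eq_conjTranspose,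
    conjTranspose_eq_transpose_of_trivial, kron_transpose,
    ← conjTranspose_eq_transpose_of_trivial, toEuclideanLin_conjTranspose_eq_adjoint,
    LinearMap.adjoint_inner_left]

theorem altHom_diagonal_apply (s : Fin d → ℝ) (t : AltSpace k d) (φ : Fin k → Fin d) :
    (altHom k d (diagonal s) t).1 φ = (∏ j, s (φ j)) * t.1 φ := by
  rw [altHom_apply, kron_diagonal, toLpLin_apply]
  simp [mulVec_diagonal]

/-- Alternating tensors vanish at non-injective multi-indices, so coordinatewise control is needed
at the injective ones only. -/
theorem AltOp.norm_le {A : AltOp k d} {c : ℝ} (hc : 0 ≤ c)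
    (h : ∀ (t : AltSpace k d) (φ : Fin k → Fin d), Function.Injective φ →
      |(A t).1 φ| ≤ c * |t.1 φ|) : ‖A‖ ≤ c := by
  refine ContinuousLinearMap.opNorm_le_bound _ hc fun t => ?_
  rw [AltSpace.norm_eq, AltSpace.norm_eq]
  refine le_of_sq_le_sq ?_ (by positivity)
  rw [mul_pow, EuclideanSpace.norm_sq_eq, EuclideanSpace.norm_sq_eq, Finset.mul_sum]
  refine Finset.sum_le_sum fun φ _ => ?_
  by_cases hφ : Function.Injective φ
  · rw [← mul_pow]
    exact pow_le_pow_left₀ (norm_nonneg _) (h t φ hφ) 2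
  · simp [Alt.apply_eq_zero (A t).2 hφ, Alt.apply_eq_zero t.2 hφ]

end Alt

end SemigroupAnosov

end

noncomputable section

namespace SemigroupAnosov

open Filter Topology Matrix

/-! ### Diagonal matrices on exterior powers. -/

section Antitone

/-- Induction removing the largest index, which is at least `k` in a set of `k + 1` naturals. -/
theorem prod_le_prod_range {s : ℕ → ℝ} (hs : Antitone s) (h0 : ∀ n, 0 ≤ s n) {k : ℕ} :
    ∀ {J : Finset ℕ}, J.card = k → ∏ j ∈ J, s j ≤ ∏ j ∈ Finset.range k, s j := by
  induction k with
  | zero => intro J hJ; simp [Finset.card_eq_zero.1 hJ]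
  | succ k ih =>
    intro J hJ
    have hne : J.Nonempty := Finset.card_pos.1 (by omega)
    have hm := J.max'_mem hne
    have hk : k ≤ J.max' hne := by
      have : J ⊆ Finset.range (J.max' hne + 1) := fun j hj =>
        Finset.mem_range.2 (Nat.lt_succ_of_le (J.le_max' j hj))
      have := Finset.card_le_card this
      simp at this
      omega
    rw [← Finset.prod_erase_mul _ _ hm, Finset.prod_range_succ]
    refine mul_le_mul (ih ?_) (hs hk) (h0 _) (Finset.prod_nonneg fun _ _ => h0 _)
    rw [Finset.card_erase_of_mem hm, hJ]; omega

theorem prod_le_prod_range_mul {s : ℕ → ℝ} (hs : Antitone s) (h0 : ∀ n, 0 ≤ s n) {k m : ℕ}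
    {J : Finset ℕ} (hJ : J.card = k + 1) (hm : m ∈ J) (hk : k + 1 ≤ m) :
    ∏ j ∈ J, s j ≤ (∏ j ∈ Finset.range k, s j) * s (k + 1) := by
  rw [← Finset.prod_erase_mul _ _ hm]
  refine mul_le_mul (prod_le_prod_range hs h0 ?_) (hs hk) (h0 _)
    (Finset.prod_nonneg fun _ _ => h0 _)
  rw [Finset.card_erase_of_mem hm, hJ]; omega

end Antitone

section AltNorm

variable {k d : ℕ}

/-- The orthogonal projection onto the first `i` coordinates. -/
def mask (d i : ℕ) : Matrix (Fin d) (Fin d) ℝ := diagonal fun j => if (j : ℕ) < i then 1 else 0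

theorem mask_mul_mask (d i : ℕ) : mask d i * mask d i = mask d i := by
  simp [mask, diagonal_mul_diagonal]

theorem star_mask (d i : ℕ) : star (mask d i) = mask d i := by
  simp [mask, star_eq_conjTranspose]

theorem isStarProjection_mask (d i : ℕ) : IsStarProjection (mask d i) :=
  ⟨mask_mul_mask d i, star_mask d i⟩

theorem altHom_mask_apply (i : ℕ) (t : AltSpace k d) (φ : Fin k → Fin d) :
    (altHom k d (mask d i) t).1 φ = if ∀ j, (φ j : ℕ) < i then t.1 φ else 0 := by
  rw [mask, altHom_diagonal_apply, Finset.prod_ite_zero]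
  simp

theorem prod_comp_eq_prod_image (s : ℕ → ℝ) {φ : Fin k → Fin d} (hφ : Function.Injective φ) :
    ∏ j, s (φ j) = ∏ x ∈ Finset.univ.image fun j => (φ j : ℕ), s x := by
  rw [Finset.prod_image]
  intro x _ y _ h
  exact hφ (Fin.ext h)

theorem card_image_val {φ : Fin k → Fin d} (hφ : Function.Injective φ) :
    (Finset.univ.image fun j => (φ j : ℕ)).card = k := by
  rw [Finset.card_image_of_injective _ fun x y h => hφ (Fin.ext h), Finset.card_fin]

theorem prod_comp_eq_prod_range (s : ℕ → ℝ) {φ : Fin k → Fin d} (hφ : Function.Injective φ)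
    (h : ∀ j, (φ j : ℕ) < k) : ∏ j, s (φ j) = ∏ j ∈ Finset.range k, s j := by
  rw [prod_comp_eq_prod_image s hφ]
  congr 1
  refine Finset.eq_of_subset_of_card_le ?_ (by rw [card_image_val hφ]; simp)
  intro x hx
  obtain ⟨j, -, rfl⟩ := Finset.mem_image.1 hx
  exact Finset.mem_range.2 (h j)

theorem norm_altHom_diagonal_le {s : ℕ → ℝ} (hs : Antitone s) (h0 : ∀ n, 0 ≤ s n) :
    ‖altHom k d (diagonal fun j : Fin d => s j)‖ ≤ ∏ j ∈ Finset.range k, s j := by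
  refine AltOp.norm_le (Finset.prod_nonneg fun _ _ => h0 _) fun t φ hφ => ?_
  rw [altHom_diagonal_apply, abs_mul, abs_of_nonneg (Finset.prod_nonneg fun _ _ => h0 _),
    prod_comp_eq_prod_image s hφ]
  exact mul_le_mul_of_nonneg_right (prod_le_prod_range hs h0 (card_image_val hφ)) (abs_nonneg _)

theorem norm_altHom_diagonal {s : ℕ → ℝ} (hs : Antitone s) (h0 : ∀ n, 0 ≤ s n) (hk : k ≤ d) :
    ‖altHom k d (diagonal fun j : Fin d => s j)‖ = ∏ j ∈ Finset.range k, s j := by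
  refine le_antisymm (norm_altHom_diagonal_le hs h0) ?_
  have hp := Finset.prod_nonneg (s := Finset.range k) fun j _ => h0 j
  -- The wedge of the first `k` basis vectors, with determinants as coordinates; it is an
  -- eigenvector attaining the norm.
  let t₀ : EuclideanSpace ℝ (Fin k → Fin d) := WithLp.toLp 2 fun φ =>
    (Matrix.of fun j l : Fin k => if (φ j : ℕ) = l then (1 : ℝ) else 0).det
  have ht₀ : t₀ ∈ Alt k d := fun σ φ => by
    exact Matrix.det_permute σ (Matrix.of fun j l : Fin k => if (φ j : ℕ) = l then (1 : ℝ) else 0)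
  have hmask : ∀ φ, t₀ φ ≠ 0 → ∀ j, (φ j : ℕ) < k := by
    intro φ hφ j
    by_contra! hj
    refine hφ (Matrix.det_eq_zero_of_row_eq_zero j fun l => ?_)
    simp only [of_apply, ite_eq_right_iff]
    omega
  have hne : t₀ ≠ 0 := by
    intro h
    have h1 : t₀ (Fin.castLE hk) = 0 := by rw [h]; rfl
    have h2 : t₀ (Fin.castLE hk) = 1 := by
      have : (Matrix.of fun j l : Fin k =>
          if ((Fin.castLE hk j : Fin d) : ℕ) = l then (1 : ℝ) else 0) = 1 := by
        ext j l
        simp [one_apply, Fin.ext_iff]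
      simp only [t₀, this, det_one]
    linarith
  obtain ⟨t, ht⟩ : ∃ t : AltSpace k d, t.1 = t₀ := ⟨⟨t₀, ht₀⟩, rfl⟩
  have hact : altHom k d (diagonal fun j : Fin d => s j) t = (∏ j ∈ Finset.range k, s j) • t := by
    refine Subtype.ext (PiLp.ext fun φ => ?_)
    change _ = (∏ j ∈ Finset.range k, s j) * t.1 φ
    rw [altHom_diagonal_apply, ht]
    by_cases hφ : t₀ φ = 0
    · simp [hφ]
    · have hinj : Function.Injective φ := by
        by_contra hcon
        exact hφ (Alt.apply_eq_zero ht₀ hcon)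
      rw [prod_comp_eq_prod_range s hinj (hmask φ hφ)]
  have h1 := (altHom k d (diagonal fun j : Fin d => s j)).le_opNorm t
  rw [hact, norm_smul, Real.norm_of_nonneg hp] at h1
  refine le_of_mul_le_mul_right h1 (norm_pos_iff.2 fun h => hne ?_)
  rw [← ht, h]
  rfl

theorem norm_altHom_mask_mul_inv_le {s : ℕ → ℝ} (h0 : ∀ j < d, 0 < s j) (hk : k ≤ d) :
    ‖altHom k d (mask d k * diagonal fun j : Fin d => (s j)⁻¹)‖ ≤
      1 / ∏ j ∈ Finset.range k, s j := by
  have hp : 0 < ∏ j ∈ Finset.range k, s j :=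
    Finset.prod_pos fun j hj => h0 j ((Finset.mem_range.1 hj).trans_le hk)
  refine AltOp.norm_le (by positivity) fun t φ hφ => ?_
  rw [map_mul, mul_apply_eq_comp, altHom_mask_apply]
  split_ifs with h
  · rw [altHom_diagonal_apply, Finset.prod_inv_distrib, prod_comp_eq_prod_range s hφ h, abs_mul,
      abs_of_pos (inv_pos.2 hp), one_div]
  · rw [abs_zero]; positivity

/-- Off the top wedge some index is at least `k + 1`; the best remaining choice replaces `s k` by `s
(k + 1)`. -/
theorem norm_altHom_diagonal_mul_compl_le {s : ℕ → ℝ} (hs : Antitone s) (h0 : ∀ n, 0 ≤ s n) :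
    ‖altHom (k + 1) d (diagonal fun j : Fin d => s j) * (1 - altHom (k + 1) d (mask d (k + 1)))‖ ≤
      (∏ j ∈ Finset.range k, s j) * s (k + 1) := by
  have hp : 0 ≤ (∏ j ∈ Finset.range k, s j) * s (k + 1) :=
    mul_nonneg (Finset.prod_nonneg fun _ _ => h0 _) (h0 _)
  refine AltOp.norm_le hp fun t φ hφ => ?_
  have e : ((1 - altHom (k + 1) d (mask d (k + 1))) t).1 φ =
      if ∀ j, (φ j : ℕ) < k + 1 then 0 else t.1 φ := by
    change t.1 φ - (altHom (k + 1) d (mask d (k + 1)) t).1 φ = _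
    rw [altHom_mask_apply]
    split_ifs <;> simp
  rw [mul_apply_eq_comp, altHom_diagonal_apply, e]
  split_ifs with h
  · rw [mul_zero, abs_zero]; positivity
  · push Not at h
    obtain ⟨j, hj⟩ := h
    rw [abs_mul, abs_of_nonneg (Finset.prod_nonneg fun _ _ => h0 _), prod_comp_eq_prod_image s hφ]
    exact mul_le_mul_of_nonneg_right (prod_le_prod_range_mul hs h0 (card_image_val hφ)
      (Finset.mem_image.2 ⟨j, Finset.mem_univ _, rfl⟩) hj) (abs_nonneg _)

end AltNorm

end SemigroupAnosov

end

noncomputable section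

namespace SemigroupAnosov

open Filter Topology Matrix
open scoped Matrix.Norms.L2Operator

/-! ### Singular projections -/

section SingularProjections

variable {d : ℕ}

/-- The singular values of `g`, indexed from `0`. -/
def sv (g : GL (Fin d) ℝ) (j : ℕ) : ℝ := (act g.val).singularValues j

theorem sv_nonneg (g : GL (Fin d) ℝ) (j : ℕ) : 0 ≤ sv g j := LinearMap.singularValues_nonneg _ _

theorem sv_antitone (g : GL (Fin d) ℝ) : Antitone (sv g) := LinearMap.singularValues_antitone _

theorem act_injective (g : GL (Fin d) ℝ) : Function.Injective (act g.val) := by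
  refine Function.LeftInverse.injective (g := act (↑g⁻¹ : Matrix (Fin d) (Fin d) ℝ)) fun x => ?_
  simp [act, toLpLin_apply]

theorem sv_pos (g : GL (Fin d) ℝ) {j : ℕ} (hj : j < d) : 0 < sv g j :=
  (act g.val).injective_iff_forall_lt_finrank_singularValues_pos.1 (act_injective g) j (by simpa)

theorem mu_eq_log_sv (g : GL (Fin d) ℝ) (j : ℕ) : mu g (j + 1) = Real.log (sv g j) := rfl

/-- The left factor of a singular value decomposition. -/
def svdLeft (g : GL (Fin d) ℝ) : Matrix (Fin d) (Fin d) ℝ := (exists_svd g).choose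

theorem svdLeft_mem (g : GL (Fin d) ℝ) : svdLeft g ∈ unitary (Matrix (Fin d) (Fin d) ℝ) :=
  (exists_svd g).choose_spec.1

/-- The right factor of a singular value decomposition. -/
def svdRight (g : GL (Fin d) ℝ) : Matrix (Fin d) (Fin d) ℝ := (exists_svd g).choose_spec.2.choose

theorem svdRight_mem (g : GL (Fin d) ℝ) : svdRight g ∈ unitary (Matrix (Fin d) (Fin d) ℝ) :=
  (exists_svd g).choose_spec.2.choose_spec.1

theorem svd_eq (g : GL (Fin d) ℝ) :
    g.val = svdLeft g * diagonal (fun j : Fin d => sv g j) * svdRight g :=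
  (exists_svd g).choose_spec.2.choose_spec.2

theorem diagonal_sv_mul_inv (g : GL (Fin d) ℝ) :
    diagonal (fun j : Fin d => sv g j) * diagonal (fun j : Fin d => (sv g j)⁻¹) = 1 := by
  simp [diagonal_mul_diagonal, fun j : Fin d => (sv_pos g j.2).ne']

theorem svd_inv_eq (g : GL (Fin d) ℝ) :
    (↑g⁻¹ : Matrix (Fin d) (Fin d) ℝ) =
      star (svdRight g) * diagonal (fun j : Fin d => (sv g j)⁻¹) * star (svdLeft g) := by
  have hU : svdLeft g * star (svdLeft g) = 1 := (Unitary.mem_iff.1 (svdLeft_mem g)).2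
  have hV : svdRight g * star (svdRight g) = 1 := (Unitary.mem_iff.1 (svdRight_mem g)).2
  refine Units.inv_eq_of_mul_eq_one_right ?_
  rw [svd_eq g]
  calc _ = svdLeft g * (diagonal (fun j : Fin d => sv g j) * (svdRight g * star (svdRight g)) *
        diagonal (fun j : Fin d => (sv g j)⁻¹)) * star (svdLeft g) := by simp only [mul_assoc]
    _ = 1 := by rw [hV, mul_one, diagonal_sv_mul_inv, mul_one, hU]

/-- The orthogonal projection onto the span of the first `i` left singular vectors. -/
def leftProj (i : ℕ) (g : GL (Fin d) ℝ) : Matrix (Fin d) (Fin d) ℝ :=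
  svdLeft g * mask d i * star (svdLeft g)

/-- The orthogonal projection onto the span of the first `i` right singular vectors. -/
def rightProj (i : ℕ) (g : GL (Fin d) ℝ) : Matrix (Fin d) (Fin d) ℝ :=
  star (svdRight g) * mask d i * svdRight g

theorem isStarProjection_conj {U P : Matrix (Fin d) (Fin d) ℝ} (hU : star U * U = 1)
    (hP : IsStarProjection P) : IsStarProjection (U * P * star U) where
  isIdempotentElem := by
    have := hP.isIdempotentElem.eq
    calc U * P * star U * (U * P * star U) = U * P * (star U * U) * P * star U := by
          simp only [mul_assoc]
      _ = U * P * star U := by rw [hU, mul_one, mul_assoc U, this]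
  isSelfAdjoint := by
    rw [IsSelfAdjoint, star_mul, star_mul, star_star, hP.isSelfAdjoint.star_eq, mul_assoc]

theorem isStarProjection_leftProj (i : ℕ) (g : GL (Fin d) ℝ) : IsStarProjection (leftProj i g) :=
  isStarProjection_conj (Unitary.mem_iff.1 (svdLeft_mem g)).1 (isStarProjection_mask d i)

theorem isStarProjection_rightProj (i : ℕ) (g : GL (Fin d) ℝ) : IsStarProjection (rightProj i g) := by
  have := isStarProjection_conj (U := star (svdRight g))
    (by rw [star_star]; exact (Unitary.mem_iff.1 (svdRight_mem g)).2) (isStarProjection_mask d i)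
  rwa [star_star] at this

theorem mask_comm_diagonal (i : ℕ) (s : Fin d → ℝ) :
    mask d i * diagonal s = diagonal s * mask d i := by
  simp only [mask, diagonal_mul_diagonal, mul_comm]

section Hom

variable {𝔄 : Type*} [NormedRing 𝔄] [StarRing 𝔄] [CStarRing 𝔄]
  (ψ : Matrix (Fin d) (Fin d) ℝ →* 𝔄) (hψ : ∀ A, ψ (star A) = star (ψ A))

include hψ

omit [CStarRing 𝔄] in
theorem map_mem_unitary {U : Matrix (Fin d) (Fin d) ℝ} (hU : U ∈ unitary (Matrix (Fin d) (Fin d) ℝ)) :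
    ψ U ∈ unitary 𝔄 := by
  rw [Unitary.mem_iff] at hU ⊢
  rw [← hψ, ← map_mul, ← map_mul, hU.1, hU.2, map_one]
  exact ⟨rfl, rfl⟩

omit [CStarRing 𝔄] in
theorem isStarProjection_map {P : Matrix (Fin d) (Fin d) ℝ} (hP : IsStarProjection P) :
    IsStarProjection (ψ P) :=
  ⟨by rw [IsIdempotentElem, ← map_mul, hP.isIdempotentElem.eq],
    by rw [IsSelfAdjoint, ← hψ, hP.isSelfAdjoint.star_eq]⟩

theorem norm_map_eq_norm_map_diagonal (g : GL (Fin d) ℝ) :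
    ‖ψ g.val‖ = ‖ψ (diagonal fun j : Fin d => sv g j)‖ := by
  conv_lhs => rw [svd_eq g, map_mul, map_mul]
  rw [CStarRing.norm_mul_mem_unitary _ (map_mem_unitary ψ hψ (svdRight_mem g)),
    CStarRing.norm_mem_unitary_mul _ (map_mem_unitary ψ hψ (svdLeft_mem g))]

/-- The gap of the image of a matrix is that of the image of its diagonal part. -/
theorem gap_map (g : GL (Fin d) ℝ) (i : ℕ) {a b : ℝ}
    (ha : ‖ψ (mask d i * diagonal fun j : Fin d => (sv g j)⁻¹)‖ ≤ 1 / a)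
    (hb : ‖ψ (diagonal fun j : Fin d => sv g j) * (1 - ψ (mask d i))‖ ≤ b) :
    Gap (Units.map ψ g) (ψ (leftProj i g)) (ψ (rightProj i g)) a b := by
  have hU := svdLeft_mem g
  have hV := svdRight_mem g
  have hUU : star (svdLeft g) * svdLeft g = 1 := (Unitary.mem_iff.1 hU).1
  have hVV : svdRight g * star (svdRight g) = 1 := (Unitary.mem_iff.1 hV).2
  have hVV' : star (svdRight g) * svdRight g = 1 := (Unitary.mem_iff.1 hV).1
  refine ⟨isStarProjection_map ψ hψ (isStarProjection_leftProj i g),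
    isStarProjection_map ψ hψ (isStarProjection_rightProj i g), ?_, ?_, ?_⟩
  · rw [Units.coe_map, ← map_mul, ← map_mul]
    congr 1
    rw [svd_eq g, leftProj, rightProj]
    calc _ = svdLeft g * diagonal (fun j : Fin d => sv g j) * (svdRight g * star (svdRight g)) *
          mask d i * svdRight g := by simp only [mul_assoc]
      _ = svdLeft g * (diagonal (fun j : Fin d => sv g j) * mask d i) * svdRight g := by
          rw [hVV, mul_one]; simp only [mul_assoc]
      _ = svdLeft g * mask d i * (star (svdLeft g) * svdLeft g) *
          diagonal (fun j : Fin d => sv g j) * svdRight g := by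
          rw [← mask_comm_diagonal, hUU, mul_one]; simp only [mul_assoc]
      _ = _ := by simp only [mul_assoc]
  · have e : rightProj i g * (↑g⁻¹ : Matrix (Fin d) (Fin d) ℝ) = star (svdRight g) *
        (mask d i * diagonal fun j : Fin d => (sv g j)⁻¹) * star (svdLeft g) := by
      rw [svd_inv_eq, rightProj]
      calc _ = star (svdRight g) * mask d i * (svdRight g * star (svdRight g)) *
            diagonal (fun j : Fin d => (sv g j)⁻¹) * star (svdLeft g) := by simp only [mul_assoc]
        _ = _ := by rw [hVV, mul_one]; simp only [mul_assoc]
    rw [← map_inv, Units.coe_map, ← map_mul, e, map_mul, map_mul,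
      CStarRing.norm_mul_mem_unitary _ (map_mem_unitary ψ hψ (Unitary.star_mem hU)),
      CStarRing.norm_mem_unitary_mul _ (map_mem_unitary ψ hψ (Unitary.star_mem hV))]
    exact ha
  · have e : ψ g.val * (1 - ψ (rightProj i g)) = ψ (svdLeft g) *
        (ψ (diagonal fun j : Fin d => sv g j) * (1 - ψ (mask d i))) * ψ (svdRight g) := by
      have e1 : g.val * rightProj i g =
          svdLeft g * diagonal (fun j : Fin d => sv g j) * mask d i * svdRight g := by
        rw [svd_eq g, rightProj]
        calc _ = svdLeft g * diagonal (fun j : Fin d => sv g j) *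
              (svdRight g * star (svdRight g)) * mask d i * svdRight g := by simp only [mul_assoc]
          _ = _ := by rw [hVV, mul_one]
      rw [mul_sub, mul_one, ← map_mul, e1]
      conv_lhs => rw [svd_eq g]
      simp only [map_mul, mul_sub, sub_mul, mul_one, mul_assoc]
    rw [Units.coe_map, e,
      CStarRing.norm_mul_mem_unitary _ (map_mem_unitary ψ hψ hV),
      CStarRing.norm_mem_unitary_mul _ (map_mem_unitary ψ hψ hU)]
    exact hb

end Hom

theorem gap_singular (g : GL (Fin d) ℝ) {k : ℕ} (hk : k < d) :
    Gap g (leftProj (k + 1) g) (rightProj (k + 1) g) (sv g k) (sv g (k + 1)) := by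
  have hpos := sv_pos g hk
  refine gap_map (MonoidHom.id _) (fun _ => rfl) g (k + 1) ?_ ?_
  · rw [MonoidHom.id_apply, mask, diagonal_mul_diagonal, l2_opNorm_diagonal,
      pi_norm_le_iff_of_nonneg (by positivity)]
    intro j
    split_ifs with h
    · rw [one_mul, norm_inv, Real.norm_of_nonneg (sv_nonneg _ _), one_div]
      exact inv_anti₀ hpos (sv_antitone g (by omega))
    · rw [zero_mul, norm_zero]; positivity
  · have e : (1 : Matrix (Fin d) (Fin d) ℝ) - mask d (k + 1) =
        diagonal fun j : Fin d => if (j : ℕ) < k + 1 then 0 else 1 := by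
      rw [mask, ← diagonal_one, diagonal_sub]
      congr 1
      ext j
      split_ifs <;> simp
    simp only [MonoidHom.id_apply]
    rw [e, diagonal_mul_diagonal, l2_opNorm_diagonal, pi_norm_le_iff_of_nonneg (sv_nonneg _ _)]
    intro j
    split_ifs with h
    · rw [mul_zero, norm_zero]; exact sv_nonneg _ _
    · rw [mul_one, Real.norm_of_nonneg (sv_nonneg _ _)]
      exact sv_antitone g (by omega)

theorem norm_altHom (g : GL (Fin d) ℝ) {k : ℕ} (hk : k ≤ d) :
    ‖altHom k d g.val‖ = ∏ j ∈ Finset.range k, sv g j := by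
  exact (norm_map_eq_norm_map_diagonal (altHom k d) altHom_star g).trans
    (norm_altHom_diagonal (sv_antitone g) (sv_nonneg g) hk)

theorem norm_altHom_pos (g : GL (Fin d) ℝ) {k : ℕ} (hk : k ≤ d) : 0 < ‖altHom k d g.val‖ := by
  rw [norm_altHom g hk]
  exact Finset.prod_pos fun j hj => sv_pos g ((Finset.mem_range.1 hj).trans_le hk)

theorem norm_altHom_succ (g : GL (Fin d) ℝ) {k : ℕ} (hk : k < d) :
    ‖altHom (k + 1) d g.val‖ = ‖altHom k d g.val‖ * sv g k := by
  rw [norm_altHom g hk, norm_altHom g hk.le, Finset.prod_range_succ]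

/-- The gap ratio is again `sv g (k + 1) / sv g k`, but the strong part now carries the full
operator norm, as `GapSystem.exists_norm_prods_mul_ge` demands. -/
theorem gap_altHom (g : GL (Fin d) ℝ) {k : ℕ} (hk : k < d) :
    Gap (Units.map (altHom (k + 1) d) g) (altHom (k + 1) d (leftProj (k + 1) g))
      (altHom (k + 1) d (rightProj (k + 1) g)) ‖altHom (k + 1) d g.val‖
      (‖altHom k d g.val‖ * sv g (k + 1)) := by
  refine gap_map _ altHom_star g (k + 1) ?_ ?_
  · rw [norm_altHom g hk]
    exact norm_altHom_mask_mul_inv_le (fun j hj => sv_pos g hj) hk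
  · rw [norm_altHom g hk.le]
    exact norm_altHom_diagonal_mul_compl_le (sv_antitone g) (sv_nonneg g)

/-- A compression of an orthogonal matrix to the first coordinates is invertible as soon as its
action on the exterior power does not vanish. -/
theorem exists_mul_compression_eq_mask {k : ℕ} (hk : k < d) {O : Matrix (Fin d) (Fin d) ℝ}
    (hO : O ∈ unitary (Matrix (Fin d) (Fin d) ℝ)) {c : ℝ} (hc : 0 < c)
    (h : c ≤ ‖altHom (k + 1) d (mask d (k + 1) * O * mask d (k + 1))‖) :
    ∃ X : Matrix (Fin d) (Fin d) ℝ, ‖X‖ ≤ 1 / c ∧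
      X * (mask d (k + 1) * O * mask d (k + 1)) = mask d (k + 1) := by
  set m := mask d (k + 1) with hm
  set M := m * O * m with hM
  have hmm : m * m = m := mask_mul_mask d (k + 1)
  have hms : star m = m := star_mask d (k + 1)
  obtain ⟨V, hV, hMV⟩ := exists_transpose_mul_self_eq M
  have hVV : V * star V = 1 := (mem_orthogonalGroup_iff _ _).1 hV
  have hVV' : star V * V = 1 := (mem_orthogonalGroup_iff' _ _).1 hV
  have hV' : star V ∈ unitary (Matrix (Fin d) (Fin d) ℝ) := Unitary.star_mem hV
  set t : ℕ → ℝ := fun j => (act M).singularValues j ^ 2 with ht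
  have ht0 : ∀ j, 0 ≤ t j := fun j => sq_nonneg _
  have htanti : Antitone t := fun i j hij =>
    pow_le_pow_left₀ (LinearMap.singularValues_nonneg _ _)
      (LinearMap.singularValues_antitone _ hij) 2
  set D : Matrix (Fin d) (Fin d) ℝ := diagonal fun j : Fin d => t j with hD
  have hMV : star M * M = star V * D * V := hMV
  have hmle : ‖m‖ ≤ 1 := (isStarProjection_mask d (k + 1)).norm_le
  have hM1 : ‖M‖ ≤ 1 := by
    have : ‖m * O‖ ≤ 1 := by rwa [CStarRing.norm_mul_mem_unitary _ hO]
    simpa using norm_mul_le_of_le_of_le this hmle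
  have htone : ∀ j, t j ≤ 1 := by
    intro j
    refine (htanti (Nat.zero_le j)).trans ?_
    have h1 : ‖D‖ ≤ 1 := by
      rw [← CStarRing.norm_mem_unitary_mul D hV', ← CStarRing.norm_mul_mem_unitary _ hV, ← hMV,
        CStarRing.norm_star_mul_self]
      exact mul_le_one₀ hM1 (norm_nonneg _) hM1
    rw [hD, l2_opNorm_diagonal] at h1
    have h2 := (norm_le_pi_norm (fun j : Fin d => t j) ⟨0, by omega⟩).trans h1
    exact (le_abs_self _).trans h2
  -- The exterior norm of `star M * M` is at most `t 0 ⋯ t k`, and all these factors are at most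
  -- `1`, so the smallest one carries the lower bound.
  have htk : c ^ 2 ≤ t k := by
    have h1 : ‖altHom (k + 1) d M‖ * ‖altHom (k + 1) d M‖ = ‖altHom (k + 1) d D‖ := by
      rw [← CStarRing.norm_star_mul_self, ← altHom_star, ← map_mul, hMV, map_mul, map_mul,
        CStarRing.norm_mul_mem_unitary _ (map_mem_unitary _ altHom_star hV),
        CStarRing.norm_mem_unitary_mul _ (map_mem_unitary _ altHom_star hV')]
    have h2 : ‖altHom (k + 1) d D‖ ≤ ∏ j ∈ Finset.range (k + 1), t j :=
      norm_altHom_diagonal_le htanti ht0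
    rw [Finset.prod_range_succ] at h2
    have h3 : ∏ j ∈ Finset.range k, t j ≤ 1 :=
      Finset.prod_le_one (fun j _ => ht0 j) fun j _ => htone j
    have h4 := mul_le_mul h h hc.le (norm_nonneg _)
    nlinarith [mul_le_mul_of_nonneg_right h3 (ht0 k)]
  have htpos : ∀ j ≤ k, 0 < t j := fun j hj => (by positivity : 0 < c ^ 2).trans_le
    (htk.trans (htanti hj))
  set E : Matrix (Fin d) (Fin d) ℝ :=
    diagonal fun j : Fin d => if (j : ℕ) < k + 1 then (t j)⁻¹ else 0 with hE
  have hED : E * D = m := by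
    rw [hE, hD, hm, mask, diagonal_mul_diagonal]
    congr 1
    ext j
    split_ifs with hj
    · exact inv_mul_cancel₀ (htpos j (by omega)).ne'
    · exact zero_mul _
  have hDE : D * E = m := by
    rw [← hED, hD, hE, diagonal_mul_diagonal, diagonal_mul_diagonal]
    simp only [mul_comm]
  have hmE : m * E = E := by
    rw [hm, mask, hE, diagonal_mul_diagonal]
    congr 1
    ext j
    split_ifs <;> simp
  have hEs : star E = E := by simp [hE, star_eq_conjTranspose]
  have hMs : star M = m * star O * m := by
    rw [hM, star_mul, star_mul, hms, mul_assoc]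
  -- The first `k + 1` right singular vectors of `M` lie in the range of `star M`, hence in that of
  -- `m`; `E` inverts `D` on them.
  have hmW : m * (star V * m) = star V * m := by
    have h1 : star M * M * star V = star V * D := by rw [hMV, mul_assoc, hVV, mul_one]
    have h2 : m * (star M * M * star V) = star M * M * star V := by
      rw [hMs]; simp only [← mul_assoc, hmm]
    rw [h1] at h2
    calc m * (star V * m) = m * (star V * D) * E := by rw [← hDE]; simp only [mul_assoc]
      _ = star V * m := by rw [h2, mul_assoc, hDE]
  have hP : star V * m * V = m := by
    set P := star V * m * V with hPdef
    have hPP : IsStarProjection P := by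
      have := isStarProjection_conj (U := star V) (by rw [star_star, hVV])
        (isStarProjection_mask d (k + 1))
      rwa [star_star] at this
    have hmP : m * P = P := by rw [hPdef, ← mul_assoc, hmW]
    have hPm : P * m = P := by
      have := congrArg star hmP
      rwa [star_mul, hPP.isSelfAdjoint.star_eq, hms] at this
    have hN : (m - P)ᴴ * (m - P) = m - P := by
      rw [← star_eq_conjTranspose, star_sub, hms, hPP.isSelfAdjoint.star_eq, sub_mul, mul_sub,
        mul_sub, hmm, hmP, hPm, hPP.isIdempotentElem.eq, sub_self, sub_zero]
    -- `m - P` is a projection of trace zero, so it vanishes.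
    have htr : (m - P).trace = 0 := by
      rw [trace_sub, hPdef, trace_mul_comm, ← mul_assoc, hVV, one_mul, sub_self]
    rw [← hN, trace_conjTranspose_mul_self_eq_zero_iff, sub_eq_zero] at htr
    exact htr.symm
  -- The pseudo-inverse of `M`; `E` has norm at most `(1 / c) ^ 2`.
  refine ⟨star V * E * V * star M, ?_, ?_⟩
  · have e : star V * E * V * star M * star (star V * E * V * star M) = star V * E * V := by
      calc _ = star V * E * V * (star M * M) * star V * E * V := by
            simp only [star_mul, star_star, hEs, mul_assoc]
        _ = star V * E * (V * star V) * D * (V * star V) * E * V := by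
            rw [hMV]; simp only [mul_assoc]
        _ = star V * (E * D * E) * V := by rw [hVV, mul_one, mul_one]; simp only [mul_assoc]
        _ = star V * E * V := by rw [hED, hmE]
    have hEn : ‖E‖ ≤ (1 / c) ^ 2 := by
      rw [hE, l2_opNorm_diagonal, pi_norm_le_iff_of_nonneg (by positivity)]
      intro j
      split_ifs with hj
      · rw [norm_inv, Real.norm_of_nonneg (ht0 _), one_div, inv_pow]
        exact inv_anti₀ (by positivity) (htk.trans (htanti (by omega)))
      · rw [norm_zero]; positivity
    refine le_of_sq_le_sq ?_ (by positivity)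
    rw [sq, ← CStarRing.norm_self_mul_star, e, CStarRing.norm_mul_mem_unitary _ hV,
      CStarRing.norm_mem_unitary_mul _ hV']
    exact hEn
  · calc star V * E * V * star M * M = star V * E * V * (star M * M) := by rw [mul_assoc]
      _ = star V * E * (V * star V) * D * V := by rw [hMV]; simp only [mul_assoc]
      _ = star V * (E * D) * V := by rw [hVV, mul_one]; simp only [mul_assoc]
      _ = m := by rw [hED, hP]

theorem exists_mul_rightProj_mul_leftProj {k : ℕ} (hk : k < d) (g g' : GL (Fin d) ℝ) {c : ℝ}
    (hc : 0 < c)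
    (h : c ≤ ‖altHom (k + 1) d (rightProj (k + 1) g) * altHom (k + 1) d (leftProj (k + 1) g')‖) :
    ∃ Z : Matrix (Fin d) (Fin d) ℝ, ‖Z‖ ≤ 1 / c ∧
      Z * (rightProj (k + 1) g * leftProj (k + 1) g') = leftProj (k + 1) g' := by
  have hU := svdLeft_mem g'
  have hV := svdRight_mem g
  have hUU : star (svdLeft g') * svdLeft g' = 1 := (Unitary.mem_iff.1 hU).1
  have hVV : svdRight g * star (svdRight g) = 1 := (Unitary.mem_iff.1 hV).2
  have e : rightProj (k + 1) g * leftProj (k + 1) g' = star (svdRight g) *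
      (mask d (k + 1) * (svdRight g * svdLeft g') * mask d (k + 1)) * star (svdLeft g') := by
    simp only [rightProj, leftProj, mul_assoc]
  rw [← map_mul, e, map_mul, map_mul,
    CStarRing.norm_mul_mem_unitary _ (map_mem_unitary _ altHom_star (Unitary.star_mem hU)),
    CStarRing.norm_mem_unitary_mul _ (map_mem_unitary _ altHom_star (Unitary.star_mem hV))] at h
  obtain ⟨X, hX, hXm⟩ := exists_mul_compression_eq_mask hk (mul_mem hV hU) hc h
  refine ⟨svdLeft g' * X * svdRight g, ?_, ?_⟩
  · rwa [CStarRing.norm_mul_mem_unitary _ hV, CStarRing.norm_mem_unitary_mul _ hU]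
  · rw [e]
    calc _ = svdLeft g' * X * (svdRight g * star (svdRight g)) *
          (mask d (k + 1) * (svdRight g * svdLeft g') * mask d (k + 1)) * star (svdLeft g') := by
          simp only [mul_assoc]
      _ = svdLeft g' * (X * (mask d (k + 1) * (svdRight g * svdLeft g') * mask d (k + 1))) *
          star (svdLeft g') := by rw [hVV, mul_one]; simp only [mul_assoc]
      _ = _ := by rw [hXm]; rfl

end SingularProjections

end SemigroupAnosov

end

noncomputable section

namespace SemigroupAnosov

open Filter Topology Matrix

/-! ### Word lengths -/

section Words

variable {Λ : Type*} [Semigroup Λ]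

/-- `γ` is a product of `k` elements of `F`. -/
def IsWord (F : Finset Λ) (k : ℕ) (γ : Λ) : Prop :=
  ∃ ℓ : ℕ, k = ℓ + 1 ∧ ∃ f : ℕ → Λ, (∀ j, f j ∈ F) ∧ wordProd f 0 ℓ = γ

theorem wordProd_congr {f g : ℕ → Λ} {k ℓ : ℕ} (h : ∀ j ≤ ℓ, f (k + j) = g (k + j)) :
    wordProd f k ℓ = wordProd g k ℓ := by
  induction ℓ with
  | zero => exact h 0 le_rfl
  | succ ℓ ih => rw [wordProd, wordProd, ih fun j hj => h j (by omega), h (ℓ + 1) le_rfl]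

theorem isWord_one {F : Finset Λ} {x : Λ} (hx : x ∈ F) : IsWord F 1 x :=
  ⟨0, rfl, fun _ => x, fun _ => hx, rfl⟩

theorem IsWord.mul_mem {F : Finset Λ} {k : ℕ} {γ x : Λ} (h : IsWord F k γ) (hx : x ∈ F) :
    IsWord F (k + 1) (γ * x) := by
  obtain ⟨ℓ, rfl, f, hf, rfl⟩ := h
  refine ⟨ℓ + 1, rfl, Function.update f (ℓ + 1) x, fun j => ?_, ?_⟩
  · rcases eq_or_ne j (ℓ + 1) with rfl | hj
    · rwa [Function.update_self]
    · rw [Function.update_of_ne hj]; exact hf j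
  · rw [wordProd]
    congr 1
    · exact wordProd_congr fun j hj => Function.update_of_ne (by omega) _ _
    · rw [zero_add, Function.update_self]

theorem IsWord.mul {F : Finset Λ} {k m : ℕ} {γ δ : Λ} (h : IsWord F k γ) (h' : IsWord F m δ) :
    IsWord F (k + m) (γ * δ) := by
  obtain ⟨ℓ, rfl, f, hf, rfl⟩ := h'
  induction ℓ with
  | zero => exact h.mul_mem (hf 0)
  | succ ℓ ih =>
    rw [wordProd, ← mul_assoc]
    exact ih.mul_mem (hf _)

theorem Generates.exists_isWord {F : Finset Λ} (hF : Generates F) (γ : Λ) : ∃ k, IsWord F k γ := by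
  have hγ : γ ∈ Subsemigroup.closure (F : Set Λ) := by rw [hF]; trivial
  induction hγ using Subsemigroup.closure_induction with
  | mem x hx => exact ⟨1, isWord_one hx⟩
  | mul x y _ _ hx hy =>
    obtain ⟨k, hk⟩ := hx
    obtain ⟨m, hm⟩ := hy
    exact ⟨k + m, hk.mul hm⟩

/-- Each letter of `F₀` is spelled in `F`. Being an identity element does not depend on the
generating set, so the exceptional length `0` occurs on both sides at once. -/
theorem exists_wordLength_le_mul {F F₀ : Finset Λ} (hF : Generates F) (hF₀ : Generates F₀) :
    ∃ R : ℕ, 0 < R ∧ ∀ γ, wordLength F γ ≤ R * wordLength F₀ γ := by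
  choose len hlen using hF.exists_isWord
  refine ⟨∑ x ∈ F₀, len x + 1, Nat.succ_pos _, fun γ => ?_⟩
  have key : ∀ m, IsWord F₀ m γ → ∃ k ≤ (∑ x ∈ F₀, len x + 1) * m, IsWord F k γ := by
    rintro m ⟨ℓ, rfl, f, hf, rfl⟩
    have hle : ∀ j, len (f j) ≤ ∑ x ∈ F₀, len x := fun j =>
      Finset.single_le_sum (fun _ _ => Nat.zero_le _) (hf j)
    induction ℓ with
    | zero => exact ⟨len (f 0), by have := hle 0; omega, hlen _⟩
    | succ ℓ ih =>
      obtain ⟨k, hk, hword⟩ := ih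
      refine ⟨k + len (f (0 + (ℓ + 1))), ?_, hword.mul (hlen _)⟩
      have := hle (0 + (ℓ + 1))
      rw [mul_add _ (ℓ + 1) 1]
      omega
  unfold wordLength
  split_ifs
  · simp
  · obtain ⟨k, hk, hword⟩ := key _ (Nat.sInf_mem (hF₀.exists_isWord γ))
    exact (Nat.sInf_le hword).trans hk

theorem exists_mu_gap_of_isAnosov {F : Finset Λ} (hF : Generates F) {d i : ℕ}
    {ρ : Λ →ₙ* GL (Fin d) ℝ} (hρ : IsAnosov ρ i) {κ : ℝ} (hκ : 0 < κ) (κ' : ℝ) :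
    ∃ c C : ℝ, 0 < c ∧ 0 ≤ C ∧ ∀ x ∈ QG F κ κ', ∀ n : ℕ,
      c * (n + 1) - C ≤ mu (ρ (wordProd (letters x) 0 n)) i
        - mu (ρ (wordProd (letters x) 0 n)) (i + 1) := by
  obtain ⟨F₀, hF₀, c, c', hc, hc', H⟩ := hρ
  obtain ⟨R, hR, hRle⟩ := exists_wordLength_le_mul hF hF₀
  have hR' : (0 : ℝ) < R := by exact_mod_cast hR
  -- The absolute value keeps the constant nonnegative, no sign being imposed on `κ'`.
  refine ⟨c / R * κ, c / R * |κ'| + c', by positivity, by positivity, fun x hx n => ?_⟩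
  refine le_trans ?_ (H _)
  have h1 : (wordLength F (wordProd (letters x) 0 n) : ℝ) ≤
      R * wordLength F₀ (wordProd (letters x) 0 n) := by exact_mod_cast hRle _
  have h2 := (hx 0 n).trans h1
  have h3 : c / R * (κ * (n + 1) - κ') ≤ c * wordLength F₀ (wordProd (letters x) 0 n) := by
    calc _ ≤ c / R * (R * wordLength F₀ (wordProd (letters x) 0 n)) := by gcongr
      _ = _ := by field_simp
  have h4 : c / R * κ' ≤ c / R * |κ'| := by gcongr; exact le_abs_self _
  linarith

end Words

end SemigroupAnosov

end

noncomputable section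

namespace SemigroupAnosov

open Filter Topology Matrix
open scoped Matrix.Norms.L2Operator

/-! ### Cocycles of matrices with a gap between two singular values -/

section NormUnits

variable {M 𝔄 : Type*} [Monoid M] [NormedRing 𝔄] (ψ : M →* 𝔄) {A B : Mˣ} {K : ℝ}

theorem norm_map_le_mul_norm_map_mul_right (hB : ‖ψ ↑B⁻¹‖ ≤ K) :
    ‖ψ A‖ ≤ K * ‖ψ ↑(A * B)‖ := by
  have e : ψ A = ψ ↑(A * B) * ψ ↑B⁻¹ := by rw [← map_mul, ← Units.val_mul, mul_inv_cancel_right]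
  rw [mul_comm, e]
  exact norm_mul_le_of_le_of_le le_rfl hB

theorem norm_map_le_mul_norm_map_mul_left (hB : ‖ψ ↑B⁻¹‖ ≤ K) :
    ‖ψ A‖ ≤ K * ‖ψ ↑(B * A)‖ := by
  have e : ψ A = ψ ↑B⁻¹ * ψ ↑(B * A) := by rw [← map_mul, ← Units.val_mul, inv_mul_cancel_left]
  rw [e]
  exact norm_mul_le_of_le_of_le hB le_rfl

theorem norm_map_mul_right_le (hB : ‖ψ B‖ ≤ K) : ‖ψ ↑(A * B)‖ ≤ K * ‖ψ A‖ := by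
  rw [Units.val_mul, map_mul, mul_comm K]
  exact norm_mul_le_of_le_of_le le_rfl hB

theorem norm_map_mul_left_le (hB : ‖ψ B‖ ≤ K) : ‖ψ ↑(B * A)‖ ≤ K * ‖ψ A‖ := by
  rw [Units.val_mul, map_mul]
  exact norm_mul_le_of_le_of_le hB le_rfl

end NormUnits

/-! ### Matrix projections, their ranges and ranks. -/

section Projections

variable {d : ℕ}

/-- The range of a matrix, as a subspace of `ℝ^d`. -/
def rangeOf (p : Matrix (Fin d) (Fin d) ℝ) : Submodule ℝ (Euc d) := LinearMap.range (act p)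

theorem act_mul (A B : Matrix (Fin d) (Fin d) ℝ) (v : Euc d) : act (A * B) v = act A (act B v) := by
  simp [act, toLpLin_apply]

theorem act_ext {A B : Matrix (Fin d) (Fin d) ℝ} (h : ∀ v, act A v = act B v) : A = B :=
  toEuclideanLin.injective (LinearMap.ext h)

theorem mem_rangeOf {p : Matrix (Fin d) (Fin d) ℝ} (hp : p * p = p) {v : Euc d} :
    v ∈ rangeOf p ↔ act p v = v := by
  refine ⟨?_, fun h => ⟨v, h⟩⟩
  rintro ⟨w, rfl⟩
  rw [← act_mul, hp]

theorem finrank_rangeOf {p : Matrix (Fin d) (Fin d) ℝ} (hp : p * p = p) :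
    (Module.finrank ℝ (rangeOf p) : ℝ) = p.trace := by
  have h : LinearMap.IsProj (rangeOf p) (act p) :=
    ⟨fun v => ⟨v, rfl⟩, fun v hv => (mem_rangeOf hp).1 hv⟩
  have e : act p = toLin (PiLp.basisFun 2 ℝ (Fin d)) (PiLp.basisFun 2 ℝ (Fin d)) p := by
    rw [← toLpLin_eq_toLin 2 2]
    rfl
  rw [← h.trace, e,
    LinearMap.trace_eq_matrix_trace ℝ (PiLp.basisFun 2 ℝ (Fin d)), LinearMap.toMatrix_toLin]

theorem starProjection_rangeOf {p : Matrix (Fin d) (Fin d) ℝ} (hp : IsStarProjection p) :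
    (rangeOf p).starProjection = toEuclideanCLM (n := Fin d) (𝕜 := ℝ) p := by
  have h : IsStarProjection (toEuclideanCLM (n := Fin d) (𝕜 := ℝ) p) :=
    ⟨by rw [IsIdempotentElem, ← map_mul, hp.isIdempotentElem.eq],
      by rw [IsSelfAdjoint, ← map_star, hp.isSelfAdjoint.star_eq]⟩
  obtain ⟨_, h2⟩ := isStarProjection_iff_eq_starProjection_range.1 h
  rw [h2]
  rfl

theorem trace_leftProj {i : ℕ} (g : GL (Fin d) ℝ) (hi : i ≤ d) : (leftProj i g).trace = i := by
  have h : (Finset.univ.filter fun j : Fin d => (j : ℕ) < i).card = i := by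
    rw [Fin.card_filter_val_lt, min_eq_right hi]
  rw [leftProj, trace_mul_comm, ← mul_assoc, (Unitary.mem_iff.1 (svdLeft_mem g)).1, one_mul, mask,
    trace_diagonal, Finset.sum_boole, h]

/-- An injective map between ranges of projections of the same rank is onto. -/
theorem inv_mul_eq_of_compl_mul_eq_zero (g : GL (Fin d) ℝ) {p p' : Matrix (Fin d) (Fin d) ℝ}
    (hp : p * p = p) (hp' : p' * p' = p') (htr : p.trace = p'.trace)
    (h : (1 - p) * g.val * p' = 0) :
    (↑g⁻¹ : Matrix (Fin d) (Fin d) ℝ) * p = p' * ((↑g⁻¹ : Matrix (Fin d) (Fin d) ℝ) * p) := by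
  rw [sub_mul, one_mul, sub_mul, sub_eq_zero] at h
  have hle : (rangeOf p').map (act g.val) ≤ rangeOf p := by
    rintro _ ⟨v, hv, rfl⟩
    rw [← (mem_rangeOf hp').1 hv, ← act_mul, h, act_mul, act_mul]
    exact ⟨_, rfl⟩
  have heq : (rangeOf p').map (act g.val) = rangeOf p := by
    refine Submodule.eq_of_le_of_finrank_eq hle ?_
    rw [← (Submodule.equivMapOfInjective _ (act_injective g) (rangeOf p')).finrank_eq]
    exact Nat.cast_injective (R := ℝ) (by rw [finrank_rangeOf hp, finrank_rangeOf hp', htr])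
  refine act_ext fun v => ?_
  have hv : act p v ∈ (rangeOf p').map (act g.val) := heq ▸ ⟨v, rfl⟩
  obtain ⟨w, hw, hwv⟩ := hv
  have e : act ((↑g⁻¹ : Matrix (Fin d) (Fin d) ℝ) * p) v = w := by
    rw [act_mul, ← hwv, ← act_mul, Units.inv_mul]
    simp [act]
  rw [act_mul p', e, (mem_rangeOf hp').1 hw]

end Projections

section MatrixCocycle

variable {d k : ℕ}

/-- A singular value is the quotient of two consecutive exterior norms, each controlled up to `K`;
hence the constant `K ^ 2` in `gapSystem_singular`. -/
theorem sv_le_of_norm_altHom_le (hk : k < d) {g h : GL (Fin d) ℝ} {K : ℝ} (hK : 0 ≤ K)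
    (h1 : ‖altHom (k + 1) d g.val‖ ≤ K * ‖altHom (k + 1) d h.val‖)
    (h2 : ‖altHom k d h.val‖ ≤ K * ‖altHom k d g.val‖) : sv g k ≤ K ^ 2 * sv h k := by
  rw [norm_altHom_succ g hk, norm_altHom_succ h hk] at h1
  have hg := norm_altHom_pos g hk.le
  refine le_of_mul_le_mul_left ?_ hg
  calc ‖altHom k d g.val‖ * sv g k ≤ K * (‖altHom k d h.val‖ * sv h k) := h1
    _ ≤ K * (K * ‖altHom k d g.val‖ * sv h k) := by
      have := sv_nonneg h k
      gcongr
    _ = _ := by ring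

variable {Y : Type*} {T : Y → Y} {g : Y → GL (Fin d) ℝ} {K C θ : ℝ}

/-- A bound for a cocycle and its inverse, in the space and in its exterior powers of degree `k`
and `k + 1`. -/
structure BoundedCocycle (g : Y → GL (Fin d) ℝ) (k : ℕ) (K : ℝ) : Prop where
  one_le : 1 ≤ K
  norm_le : ∀ y, ‖(g y).val‖ ≤ K
  norm_inv_le : ∀ y, ‖(↑(g y)⁻¹ : Matrix (Fin d) (Fin d) ℝ)‖ ≤ K
  norm_altHom_le : ∀ y, ‖altHom k d (g y).val‖ ≤ K
  norm_altHom_inv_le : ∀ y, ‖altHom k d (↑(g y)⁻¹ : Matrix (Fin d) (Fin d) ℝ)‖ ≤ K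
  norm_altHom_succ_le : ∀ y, ‖altHom (k + 1) d (g y).val‖ ≤ K
  norm_altHom_succ_inv_le : ∀ y, ‖altHom (k + 1) d (↑(g y)⁻¹ : Matrix (Fin d) (Fin d) ℝ)‖ ≤ K

theorem gapSystem_altHom (hk : k < d) (hK : BoundedCocycle g k K) (hC : 0 ≤ C) (hθ : 0 < θ)
    (hθ' : θ < 1)
    (h : ∀ n y, sv (prods T g n y) (k + 1) ≤ C * θ ^ n * sv (prods T g n y) k) :
    GapSystem T (fun y => Units.map (altHom (k + 1) d) (g y))
      (fun n y => altHom (k + 1) d (leftProj (k + 1) (prods T g n y)))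
      (fun n y => altHom (k + 1) d (rightProj (k + 1) (prods T g n y)))
      (fun n y => ‖altHom (k + 1) d (prods T g n y).val‖)
      (fun n y => ‖altHom k d (prods T g n y).val‖ * sv (prods T g n y) (k + 1)) K C θ where
  one_le := hK.one_le
  const_nonneg := hC
  rate_pos := hθ
  rate_lt := hθ'
  norm_le := hK.norm_altHom_succ_le
  norm_inv_le := hK.norm_altHom_succ_inv_le
  pos n y := norm_altHom_pos _ hk
  gap n y := by
    rw [← map_prods]
    exact gap_altHom _ hk
  ratio n y := by
    rw [norm_altHom_succ _ hk]
    calc _ ≤ ‖altHom k d (prods T g n y).val‖ * (C * θ ^ n * sv (prods T g n y) k) := by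
          gcongr
          exact h n y
      _ = _ := by ring
  right_le n y := norm_map_le_mul_norm_map_mul_right _ (hK.norm_altHom_succ_inv_le _)
  right_ge n y := norm_map_mul_right_le _ (hK.norm_altHom_succ_le _)
  left_le n y := by
    rw [prods_succ']
    exact norm_map_le_mul_norm_map_mul_left _ (hK.norm_altHom_succ_inv_le _)
  left_ge n y := by
    rw [prods_succ']
    exact norm_map_mul_left_le _ (hK.norm_altHom_succ_le _)

theorem gapSystem_singular (hk : k < d) (hK : BoundedCocycle g k K) (hC : 0 ≤ C) (hθ : 0 < θ)
    (hθ' : θ < 1)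
    (h : ∀ n y, sv (prods T g n y) (k + 1) ≤ C * θ ^ n * sv (prods T g n y) k) :
    GapSystem T g (fun n y => leftProj (k + 1) (prods T g n y))
      (fun n y => rightProj (k + 1) (prods T g n y)) (fun n y => sv (prods T g n y) k)
      (fun n y => sv (prods T g n y) (k + 1)) (K ^ 2) C θ where
  one_le := one_le_pow₀ hK.one_le
  const_nonneg := hC
  rate_pos := hθ
  rate_lt := hθ'
  norm_le y := (hK.norm_le y).trans (le_self_pow₀ hK.one_le two_ne_zero)
  norm_inv_le y := (hK.norm_inv_le y).trans (le_self_pow₀ hK.one_le two_ne_zero)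
  pos n y := sv_pos _ hk
  gap n y := gap_singular _ hk
  ratio := h
  right_le n y := sv_le_of_norm_altHom_le hk (zero_le_one.trans hK.one_le)
    (norm_map_le_mul_norm_map_mul_right _ (hK.norm_altHom_succ_inv_le _))
    (norm_map_mul_right_le _ (hK.norm_altHom_le _))
  right_ge n y := sv_le_of_norm_altHom_le hk (zero_le_one.trans hK.one_le)
    (norm_map_mul_right_le _ (hK.norm_altHom_succ_le _))
    (norm_map_le_mul_norm_map_mul_right _ (hK.norm_altHom_inv_le _))
  left_le n y := by
    rw [prods_succ']
    exact sv_le_of_norm_altHom_le hk (zero_le_one.trans hK.one_le)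
      (norm_map_le_mul_norm_map_mul_left _ (hK.norm_altHom_succ_inv_le _))
      (norm_map_mul_left_le _ (hK.norm_altHom_le _))
  left_ge n y := by
    rw [prods_succ']
    exact sv_le_of_norm_altHom_le hk (zero_le_one.trans hK.one_le)
      (norm_map_mul_left_le _ (hK.norm_altHom_succ_le _))
      (norm_map_le_mul_norm_map_mul_left _ (hK.norm_altHom_inv_le _))

theorem equivariance_iterate {𝔄 : Type*} [Ring 𝔄] {g : Y → 𝔄ˣ} {P : Y → 𝔄}
    (hPP : ∀ y, P y * P y = P y) (hP : ∀ y, (1 - P y) * (g y : 𝔄) * P (T y) = 0) (n : ℕ) (y : Y) :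
    (1 - P y) * ((prods T g n y : 𝔄ˣ) : 𝔄) * P (T^[n] y) = 0 := by
  induction n with
  | zero => simp [prods, sub_mul, hPP]
  | succ n ih =>
    have h1 := hP (T^[n] y)
    rw [← Function.iterate_succ_apply' T n y] at h1
    rw [sub_mul, one_mul, sub_mul, sub_eq_zero] at h1 ih ⊢
    calc _ = ↑(prods T g n y) * (↑(g (T^[n] y)) * P (T^[n + 1] y)) := by
          rw [prods, Units.val_mul, mul_assoc]
      _ = (↑(prods T g n y) * P (T^[n] y)) * ↑(g (T^[n] y)) * P (T^[n + 1] y) := by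
          rw [h1]; simp only [mul_assoc]
      _ = P y * ↑(prods T g n y) * (P (T^[n] y) * ↑(g (T^[n] y)) * P (T^[n + 1] y)) := by
          rw [ih]; simp only [mul_assoc]
      _ = P y * ↑(prods T g (n + 1) y) * P (T^[n + 1] y) := by
          rw [← h1, prods, Units.val_mul]; simp only [mul_assoc]

/-- The limit bundle of a cocycle of matrices with a gap between two singular values, and its
uniform contraction by the inverse cocycle. -/
theorem exists_limit_bundle (hk : k < d) (hK : BoundedCocycle g k K) (hC : 0 ≤ C) (hθ : 0 < θ)
    (hθ' : θ < 1)
    (h : ∀ n y, sv (prods T g n y) (k + 1) ≤ C * θ ^ n * sv (prods T g n y) k) :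
    ∃ P : Y → Matrix (Fin d) (Fin d) ℝ,
      (∀ y, IsStarProjection (P y)) ∧
      (∀ y, (P y).trace = k + 1) ∧
      (∃ D, ∀ n y, ‖leftProj (k + 1) (prods T g n y) - P y‖ ≤ D * θ ^ n) ∧
      (∀ y, (↑(g y)⁻¹ : Matrix (Fin d) (Fin d) ℝ) * P y =
        P (T y) * ((↑(g y)⁻¹ : Matrix (Fin d) (Fin d) ℝ) * P y)) ∧
      ∃ N, ∃ B > 0, ∀ n ≥ N, ∀ y,
        ‖(↑(prods T g n y)⁻¹ : Matrix (Fin d) (Fin d) ℝ) * P y‖ ≤ B / sv (prods T g n y) k := by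
  have : CompleteSpace (Matrix (Fin d) (Fin d) ℝ) := FiniteDimensional.complete ℝ _
  have hs := gapSystem_singular hk hK hC hθ hθ' h
  obtain ⟨P, hlim, hD, hproj, hequi⟩ := hs.exists_limit
  have htr : ∀ y, (P y).trace = k + 1 := by
    intro y
    have hcont : Continuous fun p : Matrix (Fin d) (Fin d) ℝ => p.trace :=
      continuous_id.matrix_trace
    refine tendsto_nhds_unique ((hcont.tendsto (P y)).comp (hlim y)) ?_
    simp only [Function.comp_def, trace_leftProj _ (Nat.succ_le_of_lt hk)]
    rw [← Nat.cast_succ]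
    exact tendsto_const_nhds
  -- The limits have constant rank, so the inclusion given by equivariance is an equality and can be
  -- inverted.
  have hinv : ∀ n y, (↑(prods T g n y)⁻¹ : Matrix (Fin d) (Fin d) ℝ) * P y =
      P (T^[n] y) * ((↑(prods T g n y)⁻¹ : Matrix (Fin d) (Fin d) ℝ) * P y) := fun n y =>
    inv_mul_eq_of_compl_mul_eq_zero _ (hproj _).isIdempotentElem.eq (hproj _).isIdempotentElem.eq
      (by rw [htr, htr]) (equivariance_iterate (fun y => (hproj y).isIdempotentElem.eq) hequi n y)
  refine ⟨P, hproj, htr, ⟨_, hD⟩, fun y => ?_, ?_⟩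
  · simpa [prods] using hinv 1 y
  · obtain ⟨c, hc, N, hN⟩ := (gapSystem_altHom hk hK hC hθ hθ' h).exists_norm_right_mul_left_ge
      fun n y => by rw [← map_prods]; rfl
    refine ⟨N, 1 / c, by positivity, fun n hn y => ?_⟩
    -- The left inverse of `rightProj * leftProj` has norm at most `1 / c` whatever `m`, so letting
    -- `m` tend to infinity replaces the left projection by `P`. Applied to `z = A⁻¹ * P y`, the
    -- bound reduces to the strong part of `A⁻¹`.
    have hlow : ∀ z : Matrix (Fin d) (Fin d) ℝ, ‖P (T^[n] y) * z‖ ≤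
        1 / c * ‖rightProj (k + 1) (prods T g n y) * P (T^[n] y) * z‖ := by
      intro z
      refine le_of_tendsto_of_tendsto ((hlim _).mul_const z).norm
        ((((hlim _).const_mul _).mul_const z).norm.const_mul _) ?_
      filter_upwards [eventually_ge_atTop N] with m hm
      obtain ⟨Z, hZ, hZe⟩ := exists_mul_rightProj_mul_leftProj hk _ _ hc (hN n hn m hm y)
      conv_lhs => rw [← hZe, mul_assoc Z]
      exact norm_mul_le_of_le_of_le hZ le_rfl
    have h1 := hlow ((↑(prods T g n y)⁻¹ : Matrix (Fin d) (Fin d) ℝ) * P y)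
    rw [mul_assoc (rightProj _ _), ← hinv n y, ← mul_assoc (rightProj _ _)] at h1
    have h2 := norm_mul_le_of_le_of_le (hs.gap n y).lower (hproj y).norm_le
    calc _ ≤ 1 / c * (1 / sv (prods T g n y) k * 1) := h1.trans (by gcongr)
      _ = _ := by ring

end MatrixCocycle

end SemigroupAnosov

end

noncomputable section

namespace SemigroupAnosov

open Filter Topology Matrix
open scoped Matrix.Norms.L2Operator

/-! ### Top singular subspaces as ranges of projections -/

section Xi

variable {d k : ℕ} (g : GL (Fin d) ℝ)

theorem exp_two_mul_mu {j : ℕ} (hj : j < d) : Real.exp (2 * mu g (j + 1)) = sv g j ^ 2 := by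
  rw [mu_eq_log_sv, two_mul, Real.exp_add, Real.exp_log (sv_pos g hj), sq]

theorem mul_transpose_eq :
    g.val * g.val.transpose =
      svdLeft g * diagonal (fun j : Fin d => sv g j ^ 2) * star (svdLeft g) := by
  have hV : svdRight g * star (svdRight g) = 1 := (Unitary.mem_iff.1 (svdRight_mem g)).2
  have e : g.val.transpose =
      star (svdRight g) * diagonal (fun j : Fin d => sv g j) * star (svdLeft g) := by
    have h : g.val.transpose = star g.val := by
      rw [star_eq_conjTranspose, conjTranspose_eq_transpose_of_trivial]
    rw [h]
    conv_lhs => rw [svd_eq g]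
    rw [star_mul, star_mul, star_eq_conjTranspose (diagonal _), diagonal_conjTranspose, mul_assoc]
    simp
  rw [e]
  conv_lhs => enter [1]; rw [svd_eq g]
  calc _ = svdLeft g * diagonal (fun j : Fin d => sv g j) * (svdRight g * star (svdRight g)) *
        diagonal (fun j : Fin d => sv g j) * star (svdLeft g) := by simp only [mul_assoc]
    _ = svdLeft g * (diagonal (fun j : Fin d => sv g j) * diagonal (fun j : Fin d => sv g j)) *
        star (svdLeft g) := by rw [hV, mul_one]; simp only [mul_assoc]
    _ = _ := by rw [diagonal_mul_diagonal]; simp only [sq]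

theorem conj_diagonal_mul_conj_diagonal (a b : Fin d → ℝ) :
    (svdLeft g * diagonal a * star (svdLeft g)) * (svdLeft g * diagonal b * star (svdLeft g)) =
      svdLeft g * diagonal (fun j => a j * b j) * star (svdLeft g) := by
  have hU : star (svdLeft g) * svdLeft g = 1 := (Unitary.mem_iff.1 (svdLeft_mem g)).1
  calc _ = svdLeft g * diagonal a * (star (svdLeft g) * svdLeft g) * diagonal b *
        star (svdLeft g) := by simp only [mul_assoc]
    _ = svdLeft g * (diagonal a * diagonal b) * star (svdLeft g) := by
        rw [hU, mul_one]; simp only [mul_assoc]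
    _ = _ := by rw [diagonal_mul_diagonal]

/-- A partial resolvent times `g gᵗ - r` equals `1 - leftProj k g`, which therefore kills the
eigenspace. -/
theorem eigenspace_le_rangeOf_leftProj {r : ℝ} (hr : ∀ j : Fin d, k ≤ j → sv g j ^ 2 ≠ r) :
    Module.End.eigenspace (act (g.val * g.val.transpose)) r ≤ rangeOf (leftProj k g) := by
  intro v hv
  rw [Module.End.mem_eigenspace_iff] at hv
  rw [mem_rangeOf (isStarProjection_leftProj k g).isIdempotentElem.eq]
  have hU : svdLeft g * star (svdLeft g) = 1 := (Unitary.mem_iff.1 (svdLeft_mem g)).2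
  have h1 : (svdLeft g * diagonal (fun j : Fin d => if (j : ℕ) < k then 0 else (sv g j ^ 2 - r)⁻¹) *
      star (svdLeft g)) * (g.val * g.val.transpose - r • 1) = 1 - leftProj k g := by
    have e : g.val * g.val.transpose - r • 1 =
        svdLeft g * diagonal (fun j : Fin d => sv g j ^ 2 - r) * star (svdLeft g) := by
      have : diagonal (fun j : Fin d => sv g j ^ 2 - r) =
          diagonal (fun j : Fin d => sv g j ^ 2) - r • 1 := by
        rw [smul_one_eq_diagonal, diagonal_sub]
      rw [mul_transpose_eq, this, mul_sub, sub_mul, mul_smul_comm, smul_mul_assoc, mul_one, hU]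
    have e' : diagonal (fun j : Fin d =>
        (if (j : ℕ) < k then 0 else (sv g j ^ 2 - r)⁻¹) * (sv g j ^ 2 - r)) = 1 - mask d k := by
      rw [mask, ← diagonal_one, diagonal_sub]
      congr 1
      ext j
      split_ifs with hj
      · simp
      · rw [inv_mul_cancel₀ (sub_ne_zero.2 (hr j (not_lt.1 hj))), sub_zero]
    rw [e, conj_diagonal_mul_conj_diagonal, e', mul_sub, sub_mul, mul_one, hU, leftProj]
  have h2 : act (1 - leftProj k g) v = 0 := by
    rw [← h1, act_mul]
    have : act (g.val * g.val.transpose - r • 1) v = 0 := by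
      have e : act (g.val * g.val.transpose - r • 1) v = act (g.val * g.val.transpose) v - r • v := by
        simp [act]
      rw [e, hv, sub_self]
    rw [this, map_zero]
  have e : act (1 - leftProj k g) v = v - act (leftProj k g) v := by simp [act]
  rw [e, sub_eq_zero] at h2
  exact h2.symm

theorem Xi_eq_rangeOf_leftProj (hk : k < d) (h : sv g (k + 1) < sv g k) :
    Xi (k + 1) g = rangeOf (leftProj (k + 1) g) := by
  refine le_antisymm (iSup₂_le fun j hj => ?_) ?_
  · obtain ⟨hj1, hj2⟩ := Finset.mem_Icc.1 hj
    obtain ⟨j, rfl⟩ := Nat.exists_eq_add_of_le' hj1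
    rw [exp_two_mul_mu g (by omega)]
    refine eigenspace_le_rangeOf_leftProj g fun l hl => ne_of_lt ?_
    refine pow_lt_pow_left₀ ?_ (sv_nonneg _ _) two_ne_zero
    calc sv g l ≤ sv g (k + 1) := sv_antitone g hl
      _ < sv g k := h
      _ ≤ sv g j := sv_antitone g (by omega)
  · rintro _ ⟨v, rfl⟩
    have hmask : mask d (k + 1) =
        ∑ l ∈ Finset.univ.filter fun l : Fin d => (l : ℕ) < k + 1, diagonal (Pi.single l 1) := by
      ext a b
      rw [Matrix.sum_apply, mask]
      rcases eq_or_ne a b with rfl | hab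
      · simp [Pi.single_apply, Finset.sum_ite_eq]
      · simp [diagonal_apply_ne _ hab]
    have hsum : act (leftProj (k + 1) g) v = 
        ∑ l ∈ Finset.univ.filter fun l : Fin d => (l : ℕ) < k + 1,
        act (svdLeft g * diagonal (Pi.single l 1) * star (svdLeft g)) v := by
      rw [leftProj, hmask, Finset.mul_sum, Finset.sum_mul, act, map_sum, LinearMap.sum_apply]
      rfl
    rw [hsum]
    refine Submodule.sum_mem _ fun l hl => ?_
    have hl' : (l : ℕ) < k + 1 := (Finset.mem_filter.1 hl).2
    refine Submodule.mem_iSup_of_mem ((l : ℕ) + 1) (Submodule.mem_iSup_of_mem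
      (Finset.mem_Icc.2 ⟨by omega, by omega⟩) ?_)
    rw [Module.End.mem_eigenspace_iff, exp_two_mul_mu g l.2, ← act_mul, mul_transpose_eq,
      conj_diagonal_mul_conj_diagonal]
    have e : diagonal (fun j : Fin d => sv g j ^ 2 * (Pi.single l 1 : Fin d → ℝ) j) =
        sv g l ^ 2 • diagonal (Pi.single l 1) := by
      rw [← diagonal_smul]
      congr 1
      ext j
      rcases eq_or_ne j l with rfl | hjl
      · simp
      · simp [hjl]
    rw [e, mul_smul_comm, smul_mul_assoc]
    simp [act]

end Xi

/-! ### The Grassmannian -/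

section Grassmannian

variable {k d : ℕ}

instance : T2Space (Gr k d) :=
  T2Space.of_injective_continuous (f := fun V : Gr k d => V.1.starProjection)
    (fun _ _ h => Subtype.ext (Submodule.starProjection_inj.1 h)) continuous_induced_dom

theorem ConvergesInGr.unique {V : ℕ → Submodule ℝ (Euc d)} {W W' : Gr k d}
    (h : ConvergesInGr V W) (h' : ConvergesInGr V W') : W = W' := by
  obtain ⟨u, hu, hlim⟩ := h
  obtain ⟨u', hu', hlim'⟩ := h'
  refine tendsto_nhds_unique hlim (hlim'.congr' ?_)
  filter_upwards [hu, hu'] with n h1 h2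
  exact Subtype.ext (h2.trans h1.symm)

/-- The `k`-plane onto which an orthogonal projection of trace `k` projects. -/
def grOf {p : Matrix (Fin d) (Fin d) ℝ} (hp : IsStarProjection p) (htr : p.trace = k) : Gr k d :=
  ⟨rangeOf p, Nat.cast_injective (R := ℝ)
    ((finrank_rangeOf hp.isIdempotentElem.eq).trans htr)⟩

theorem continuous_toEuclideanCLM :
    Continuous (toEuclideanCLM (n := Fin d) (𝕜 := ℝ)) :=
  (AddMonoidHomClass.isometry_of_norm _ fun A => l2_opNorm_toEuclideanCLM A).continuous

theorem tendsto_grOf {ι : Type*} {l : Filter ι} {p : ι → Matrix (Fin d) (Fin d) ℝ}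
    {q : Matrix (Fin d) (Fin d) ℝ} (hp : ∀ n, IsStarProjection (p n))
    (htr : ∀ n, (p n).trace = k) (hq : IsStarProjection q) (hq' : q.trace = k)
    (h : Tendsto p l (𝓝 q)) : Tendsto (fun n => grOf (hp n) (htr n)) l (𝓝 (grOf hq hq')) := by
  rw [nhds_induced, tendsto_comap_iff]
  have e : (fun V : Gr k d => V.1.starProjection) ∘ (fun n => grOf (hp n) (htr n)) =
      fun n => toEuclideanCLM (n := Fin d) (𝕜 := ℝ) (p n) :=
    funext fun n => starProjection_rangeOf (hp n)
  have e' : (grOf hq hq').1.starProjection = toEuclideanCLM (n := Fin d) (𝕜 := ℝ) q :=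
    starProjection_rangeOf hq
  rw [e, e']
  exact (continuous_toEuclideanCLM.tendsto q).comp h

theorem continuous_grOf {X : Type*} [TopologicalSpace X] {p : X → Matrix (Fin d) (Fin d) ℝ}
    (hp : ∀ x, IsStarProjection (p x)) (htr : ∀ x, (p x).trace = k) (h : Continuous p) :
    Continuous fun x => grOf (hp x) (htr x) :=
  continuous_iff_continuousAt.2 fun _ => tendsto_grOf hp htr _ _ h.continuousAt

end Grassmannian

/-! ### Domination -/

section Domination

variable {d k : ℕ} {Y : Type*} {T : Y → Y} {g : Y → GL (Fin d) ℝ} {K C θ : ℝ}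

theorem norm_act_le (A : Matrix (Fin d) (Fin d) ℝ) (v : Euc d) : ‖act A v‖ ≤ ‖A‖ * ‖v‖ := by
  rw [← l2_opNorm_toEuclideanCLM]
  exact (toEuclideanCLM (n := Fin d) (𝕜 := ℝ) A).le_opNorm v

theorem act_eq_zero_of_mem_orthogonal {p : Matrix (Fin d) (Fin d) ℝ} (hp : IsStarProjection p)
    {w : Euc d} (hw : w ∈ (rangeOf p)ᗮ) : act p w = 0 := by
  have h := (rangeOf p).starProjection_apply_eq_zero_iff.2 hw
  rwa [starProjection_rangeOf hp] at h

theorem norm_prods_le {𝔄 : Type*} [NormedRing 𝔄] [NormOneClass 𝔄] {g : Y → 𝔄ˣ} {K : ℝ}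
    (h : ∀ y, ‖(g y : 𝔄)‖ ≤ K) (n : ℕ) (y : Y) : ‖((prods T g n y : 𝔄ˣ) : 𝔄)‖ ≤ K ^ n := by
  induction n with
  | zero => simp [prods]
  | succ n ih =>
    rw [prods, Units.val_mul, pow_succ]
    exact norm_mul_le_of_le_of_le ih (h _)

theorem norm_prods_inv_le {𝔄 : Type*} [NormedRing 𝔄] [NormOneClass 𝔄] {g : Y → 𝔄ˣ} {K : ℝ}
    (h : ∀ y, ‖(↑(g y)⁻¹ : 𝔄)‖ ≤ K) (n : ℕ) (y : Y) :
    ‖(↑(prods T g n y)⁻¹ : 𝔄)‖ ≤ K ^ n := by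
  induction n with
  | zero => simp [prods]
  | succ n ih =>
    rw [prods, _root_.mul_inv_rev, Units.val_mul, pow_succ']
    exact norm_mul_le_of_le_of_le (h _) ih

/-- A vector nearly orthogonal to the left singular subspace is not contracted too much by the
inverse. -/
theorem le_sv_mul_norm_act_inv (A : GL (Fin d) ℝ) (hk : k < d)
    {p : Matrix (Fin d) (Fin d) ℝ} (hp : ‖leftProj (k + 1) A - p‖ ≤ 1 / 2) {w : Euc d}
    (hw : act p w = 0) (hw1 : ‖w‖ = 1) :
    1 / 2 ≤ sv A (k + 1) * ‖act (↑A⁻¹ : Matrix (Fin d) (Fin d) ℝ) w‖ := by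
  have hgap := gap_singular A hk
  have e1 : act (leftProj (k + 1) A - p) w = act (leftProj (k + 1) A) w := by
    have : act (leftProj (k + 1) A - p) w = act (leftProj (k + 1) A) w - act p w := by simp [act]
    rw [this, hw, sub_zero]
  have e2 : act (1 - leftProj (k + 1) A) w = w - act (leftProj (k + 1) A) w := by simp [act]
  have h1 : ‖act (leftProj (k + 1) A) w‖ ≤ 1 / 2 := by
    rw [← e1]
    refine (norm_act_le _ _).trans ?_
    rwa [hw1, mul_one]
  have h2 : 1 / 2 ≤ ‖act (1 - leftProj (k + 1) A) w‖ := by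
    rw [e2]
    have := norm_sub_norm_le w (act (leftProj (k + 1) A) w)
    linarith
  have e3 : 1 - leftProj (k + 1) A =
      A.val * (1 - rightProj (k + 1) A) * (↑A⁻¹ : Matrix (Fin d) (Fin d) ℝ) := by
    rw [← hgap.upper_comm, mul_assoc, Units.mul_inv, mul_one]
  rw [e3, act_mul] at h2
  refine h2.trans ((norm_act_le _ _).trans ?_)
  gcongr
  exact hgap.upper

theorem one_le_norm_mul_norm_act_inv (A : GL (Fin d) ℝ) {w : Euc d} (hw : ‖w‖ = 1) :
    1 ≤ ‖A.val‖ * ‖act (↑A⁻¹ : Matrix (Fin d) (Fin d) ℝ) w‖ := by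
  have h := norm_act_le A.val (act (↑A⁻¹ : Matrix (Fin d) (Fin d) ℝ) w)
  rw [← act_mul, Units.mul_inv] at h
  simpa [act, hw] using h

theorem exists_norm_act_inv_le (hk : k + 1 < d) (hK : BoundedCocycle g k K) (hC : 0 ≤ C)
    (hθ : 0 < θ) (hθ' : θ < 1)
    (h : ∀ n y, sv (prods T g n y) (k + 1) ≤ C * θ ^ n * sv (prods T g n y) k)
    {P : Y → Matrix (Fin d) (Fin d) ℝ} (hP : ∀ y, IsStarProjection (P y)) {D : ℝ}
    (hD : ∀ n y, ‖leftProj (k + 1) (prods T g n y) - P y‖ ≤ D * θ ^ n) {N : ℕ} {B : ℝ}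
    (hB : 0 < B) (hN : ∀ n ≥ N, ∀ y,
      ‖(↑(prods T g n y)⁻¹ : Matrix (Fin d) (Fin d) ℝ) * P y‖ ≤ B / sv (prods T g n y) k) :
    ∃ M > 0, ∀ n y (v w : Euc d), v ∈ rangeOf (P y) → ‖v‖ = 1 → w ∈ (rangeOf (P y))ᗮ → ‖w‖ = 1 →
      ‖act (↑(prods T g n y)⁻¹ : Matrix (Fin d) (Fin d) ℝ) v‖ ≤
        M * θ ^ n * ‖act (↑(prods T g n y)⁻¹ : Matrix (Fin d) (Fin d) ℝ) w‖ := by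
  have : Nonempty (Fin d) := ⟨⟨k, by omega⟩⟩
  have hK0 : 0 < K := zero_lt_one.trans_le hK.one_le
  have hsmall : ∀ᶠ n in atTop, D * θ ^ n ≤ 1 / 2 := by
    have ht := (tendsto_pow_atTop_nhds_zero_of_lt_one hθ.le hθ').const_mul D
    rw [mul_zero] at ht
    exact ht.eventually_le_const (by norm_num)
  obtain ⟨N', hN'⟩ := eventually_atTop.1 hsmall
  -- The first summand serves large `n`; the second serves the finitely many small `n`, where only
  -- the crude bounds by `K ^ n` are available.
  have hM1 : 0 < 2 * B * C + K ^ (2 * max N N') / θ ^ max N N' := by positivity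
  refine ⟨_, hM1, fun n y v w hv hv1 hw hw1 => ?_⟩
  set A := prods T g n y with hA
  set x := ‖act (↑A⁻¹ : Matrix (Fin d) (Fin d) ℝ) v‖
  set z := ‖act (↑A⁻¹ : Matrix (Fin d) (Fin d) ℝ) w‖
  have hz : 0 ≤ z := norm_nonneg _
  rcases le_total (max N N') n with hn | hn
  · have ha := sv_pos A (show k < d by omega)
    have hx : x ≤ B / sv A k := by
      have e : act (↑A⁻¹ : Matrix (Fin d) (Fin d) ℝ) v =
          act ((↑A⁻¹ : Matrix (Fin d) (Fin d) ℝ) * P y) v := by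
        rw [act_mul, (mem_rangeOf (hP y).isIdempotentElem.eq).1 hv]
      have hle := norm_act_le ((↑A⁻¹ : Matrix (Fin d) (Fin d) ℝ) * P y) v
      rw [← e, hv1, mul_one] at hle
      exact hle.trans (hN n (le_of_max_le_left hn) y)
    have hb : 1 / 2 ≤ sv A (k + 1) * z := le_sv_mul_norm_act_inv A (by omega)
      ((hD n y).trans (hN' n (le_of_max_le_right hn)))
      (act_eq_zero_of_mem_orthogonal (hP y) hw) hw1
    have h3 : 1 / 2 ≤ C * θ ^ n * sv A k * z := hb.trans (by gcongr; exact h n y)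
    have h4 : B / sv A k ≤ 2 * B * C * θ ^ n * z := by
      rw [div_le_iff₀ ha]
      nlinarith
    refine hx.trans (h4.trans ?_)
    gcongr
    exact le_add_of_nonneg_right (by positivity)
  · have hx : x ≤ K ^ n := by
      have := norm_act_le (↑A⁻¹ : Matrix (Fin d) (Fin d) ℝ) v
      rw [hv1, mul_one] at this
      exact this.trans (norm_prods_inv_le hK.norm_inv_le n y)
    have hz1 : 1 ≤ K ^ n * z := (one_le_norm_mul_norm_act_inv A hw1).trans
      (by gcongr; exact norm_prods_le hK.norm_le n y)
    have h5 : 1 ≤ θ ^ n / θ ^ max N N' := by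
      rw [one_le_div (by positivity)]
      exact pow_le_pow_of_le_one hθ.le hθ'.le hn
    calc x ≤ K ^ n * 1 := by rwa [mul_one]
      _ ≤ K ^ n * (K ^ n * z) := by gcongr
      _ = K ^ (2 * n) * z * 1 := by ring
      _ ≤ K ^ (2 * max N N') * z * (θ ^ n / θ ^ max N N') := by
        have := pow_le_pow_right₀ hK.one_le (show 2 * n ≤ 2 * max N N' by omega)
        gcongr
      _ = K ^ (2 * max N N') / θ ^ max N N' * θ ^ n * z := by ring
      _ ≤ _ := by
        gcongr
        exact le_add_of_nonneg_left (by positivity)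

end Domination

end SemigroupAnosov

end

noncomputable section

namespace SemigroupAnosov

open Filter Topology Matrix
open scoped Matrix.Norms.L2Operator

/-! ### The cocycle of an Anosov homomorphism over quasigeodesic sequences -/

section Quasigeodesic

variable {Λ : Type*} [Semigroup Λ] {F : Finset Λ} {d k : ℕ} {ρ : Λ →ₙ* GL (Fin d) ℝ} {κ κ' : ℝ}

/-- The matrix of the first letter of a sequence. -/
def firstMatrix (ρ : Λ →ₙ* GL (Fin d) ℝ) (x : QG F κ κ') : GL (Fin d) ℝ := ρ (letters x.1 0)

theorem qgCocycle_iterate_apply (n m : ℕ) (x : QG F κ κ') :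
    ((qgCocycle ρ F κ κ').T^[n] x).1 m = x.1 (m + n) := by
  induction n generalizing m with
  | zero => rfl
  | succ n ih =>
    rw [Function.iterate_succ_apply']
    exact (ih (m + 1)).trans (congrArg x.1 (by omega))

theorem firstMatrix_iterate (n : ℕ) (x : QG F κ κ') :
    firstMatrix ρ ((qgCocycle ρ F κ κ').T^[n] x) = ρ (letters x.1 n) := by
  rw [firstMatrix, letters, qgCocycle_iterate_apply, zero_add]
  rfl

theorem prods_firstMatrix_succ (n : ℕ) (x : QG F κ κ') :
    prods (qgCocycle ρ F κ κ').T (firstMatrix ρ) (n + 1) x =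
      ρ (wordProd (letters x.1) 0 n) := by
  induction n with
  | zero => simp [prods, firstMatrix, wordProd]
  | succ n ih => rw [prods, ih, firstMatrix_iterate, wordProd, map_mul, zero_add]

theorem qgCocycle_iter (n : ℕ) (x : QG F κ κ') :
    (qgCocycle ρ F κ κ').iter n x = (prods (qgCocycle ρ F κ κ').T (firstMatrix ρ) n x)⁻¹ := by
  induction n with
  | zero => simp [prods, LinearCocycle.iter]
  | succ n ih =>
    rw [prods, _root_.mul_inv_rev, ← ih]
    rfl

theorem exists_boundedCocycle_firstMatrix (ρ : Λ →ₙ* GL (Fin d) ℝ) (F : Finset Λ) (κ κ' : ℝ)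
    (k : ℕ) : ∃ K, BoundedCocycle (firstMatrix (F := F) (κ := κ) (κ' := κ') ρ) k K := by
  have hfin : ∀ f : GL (Fin d) ℝ → ℝ, ∃ K, ∀ x : QG F κ κ', f (firstMatrix ρ x) ≤ K := fun f => by
    obtain ⟨K, hK⟩ := (Set.finite_range fun a : Letter F => f (ρ a.1)).bddAbove
    exact ⟨K, fun x => hK ⟨x.1 0, rfl⟩⟩
  obtain ⟨K₁, h₁⟩ := hfin fun g => ‖g.val‖
  obtain ⟨K₂, h₂⟩ := hfin fun g => ‖(↑g⁻¹ : Matrix (Fin d) (Fin d) ℝ)‖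
  obtain ⟨K₃, h₃⟩ := hfin fun g => ‖altHom k d g.val‖
  obtain ⟨K₄, h₄⟩ := hfin fun g => ‖altHom k d (↑g⁻¹ : Matrix (Fin d) (Fin d) ℝ)‖
  obtain ⟨K₅, h₅⟩ := hfin fun g => ‖altHom (k + 1) d g.val‖
  obtain ⟨K₆, h₆⟩ := hfin fun g => ‖altHom (k + 1) d (↑g⁻¹ : Matrix (Fin d) (Fin d) ℝ)‖
  refine ⟨1 ⊔ K₁ ⊔ K₂ ⊔ K₃ ⊔ K₄ ⊔ K₅ ⊔ K₆, ?_, fun y => (h₁ y).trans ?_, fun y => (h₂ y).trans ?_,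
    fun y => (h₃ y).trans ?_, fun y => (h₄ y).trans ?_, fun y => (h₅ y).trans ?_,
    fun y => (h₆ y).trans ?_⟩ <;> simp

theorem exists_sv_ratio_of_isAnosov (hF : Generates F) (hk : k + 1 < d) (hρ : IsAnosov ρ (k + 1))
    (hκ : 0 < κ) (κ' : ℝ) :
    ∃ C θ : ℝ, 0 ≤ C ∧ 0 < θ ∧ θ < 1 ∧ ∀ n (x : QG F κ κ'),
      sv (prods (qgCocycle ρ F κ κ').T (firstMatrix ρ) n x) (k + 1) ≤
        C * θ ^ n * sv (prods (qgCocycle ρ F κ κ').T (firstMatrix ρ) n x) k := by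
  obtain ⟨c, C, hc, hC, H⟩ := exists_mu_gap_of_isAnosov hF hρ hκ κ'
  refine ⟨Real.exp C, Real.exp (-c), (Real.exp_pos _).le, Real.exp_pos _,
    by simpa using hc, fun n x => ?_⟩
  rcases n with _ | n
  -- The empty product is not a word of the semigroup and is handled by `1 ≤ exp C`.
  · rw [pow_zero, mul_one]
    exact (sv_antitone _ k.le_succ).trans
      (le_mul_of_one_le_left (sv_nonneg _ _) (Real.one_le_exp hC))
  · rw [prods_firstMatrix_succ]
    have h := H x.1 x.2 n
    rw [mu_eq_log_sv, mu_eq_log_sv] at h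
    have ha := sv_pos (ρ (wordProd (letters x.1) 0 n)) (show k < d by omega)
    have hb := sv_pos (ρ (wordProd (letters x.1) 0 n)) hk
    rw [← Real.exp_nat_mul, ← Real.exp_add]
    conv_rhs => rw [← Real.exp_log ha, ← Real.exp_add]
    rw [← Real.log_le_iff_le_exp hb]
    push_cast
    linarith

theorem continuous_comp_wordProd {X : Type*} [TopologicalSpace X] (f : Λ → X) (n : ℕ) :
    Continuous fun x : QG F κ κ' => f (wordProd (letters x.1) 0 n) := by
  let _ : TopologicalSpace Λ := ⊥
  have _ : DiscreteTopology Λ := ⟨rfl⟩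
  exact (continuous_of_discreteTopology (f := f)).comp
    ((continuous_wordProd (id : Λ → Λ) 0 n).comp continuous_subtype_val)

/-- Domination of the limit bundle over a quasigeodesic shift space. -/
theorem exists_isDominatedBundle (hF : Generates F) (hk : k + 1 < d) (hρ : IsAnosov ρ (k + 1))
    (hκ : 0 < κ) (κ' : ℝ) :
    ∃ E : QG F κ κ' → Gr (k + 1) d, (qgCocycle ρ F κ κ').IsDominatedBundle E ∧ ∀ x,
      (∀ᶠ n in atTop, mu (ρ (wordProd (letters x.1) 0 n)) (k + 1 + 1) <
        mu (ρ (wordProd (letters x.1) 0 n)) (k + 1)) ∧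
      ConvergesInGr (fun n : ℕ => Xi (k + 1) (ρ (wordProd (letters x.1) 0 n))) (E x) := by
  have hk' : k < d := by omega
  obtain ⟨K, hK⟩ := exists_boundedCocycle_firstMatrix ρ F κ κ' k
  obtain ⟨C, θ, hC, hθ, hθ', h⟩ := exists_sv_ratio_of_isAnosov hF hk hρ hκ κ'
  obtain ⟨P, hP, htr, ⟨D, hD⟩, hequi, N, B, hB, hN⟩ := exists_limit_bundle hk' hK hC hθ hθ' h
  obtain ⟨M, hM, hdom⟩ := exists_norm_act_inv_le hk hK hC hθ hθ' h hP hD hB hN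
  have htr' : ∀ y, (P y).trace = (k + 1 : ℕ) := fun y => by rw [htr, Nat.cast_succ]
  have hpow : Tendsto (fun n : ℕ => θ ^ (n + 1)) atTop (𝓝 0) :=
    (tendsto_pow_atTop_nhds_zero_of_lt_one hθ.le hθ').comp (tendsto_add_atTop_nat 1)
  have hD' : ∀ (n : ℕ) (x : QG F κ κ'),
      ‖leftProj (k + 1) (ρ (wordProd (letters x.1) 0 n)) - P x‖ ≤ D * θ ^ (n + 1) := fun n x => by
    rw [← prods_firstMatrix_succ]
    exact hD (n + 1) x
  have hDlim : Tendsto (fun n : ℕ => D * θ ^ (n + 1)) atTop (𝓝 0) := by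
    simpa using hpow.const_mul D
  have hPcont : Continuous P := by
    -- Each approximation depends on finitely many letters, hence is continuous, and the rate does
    -- not depend on the sequence.
    have hunif : TendstoUniformly
        (fun n (x : QG F κ κ') => leftProj (k + 1) (ρ (wordProd (letters x.1) 0 n))) P atTop := by
      rw [Metric.tendstoUniformly_iff]
      intro ε hε
      filter_upwards [hDlim.eventually_lt_const hε] with n hn x
      rw [dist_comm, dist_eq_norm]
      exact (hD' n x).trans_lt hn
    exact hunif.continuous (Frequently.of_forall fun n =>
      continuous_comp_wordProd (fun γ => leftProj (k + 1) (ρ γ)) n)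
  refine ⟨fun x => grOf (hP x) (htr' x), ⟨continuous_grOf hP htr' hPcont, fun x => ?_, ?_⟩,
    fun x => ?_⟩
  · have hle : (rangeOf (P x)).map (act (↑(firstMatrix ρ x)⁻¹ : Matrix (Fin d) (Fin d) ℝ)) ≤
        rangeOf (P ((qgCocycle ρ F κ κ').T x)) := by
      rintro _ ⟨_, ⟨v, rfl⟩, rfl⟩
      rw [← act_mul, hequi, act_mul]
      exact ⟨_, rfl⟩
    refine Submodule.eq_of_le_of_finrank_eq hle ?_
    exact (Submodule.equivMapOfInjective _ (act_injective (firstMatrix ρ x)⁻¹)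
      (rangeOf (P x))).finrank_eq.symm.trans <| (grOf (hP x) (htr' x)).2.trans (grOf (hP _) (htr' _)).2.symm
  -- The `+ 1` only makes the additive constant strictly positive.
  · refine ⟨-Real.log θ, |Real.log M| + 1, neg_pos.2 (Real.log_neg hθ hθ'), by positivity,
      fun n x v w hv hv1 hw hw1 => ?_⟩
    rw [qgCocycle_iter]
    have hpos : ∀ u : Euc d, ‖u‖ = 1 → 0 < ‖act (↑(prods (qgCocycle ρ F κ κ').T
        (firstMatrix ρ) n x)⁻¹ : Matrix (Fin d) (Fin d) ℝ) u‖ := fun u hu => by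
      rw [norm_pos_iff, Ne, map_eq_zero_iff _ (act_injective _), ← norm_eq_zero, hu]
      exact one_ne_zero
    have hlog := Real.log_le_log (hpos v hv1) (hdom n x v w hv hv1 hw hw1)
    rw [Real.log_mul (by positivity) (hpos w hw1).ne', Real.log_mul hM.ne' (by positivity),
      Real.log_pow] at hlog
    have := le_abs_self (Real.log M)
    linarith
  · have hev : ∀ᶠ n : ℕ in atTop, sv (ρ (wordProd (letters x.1) 0 n)) (k + 1) <
        sv (ρ (wordProd (letters x.1) 0 n)) k := by
      have hlim : Tendsto (fun n : ℕ => C * θ ^ (n + 1)) atTop (𝓝 0) := by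
        simpa using hpow.const_mul C
      filter_upwards [hlim.eventually_lt_const one_pos] with n hn
      rw [← prods_firstMatrix_succ]
      exact (h (n + 1) x).trans_lt (mul_lt_of_lt_one_left (sv_pos _ hk') hn)
    refine ⟨hev.mono fun n hn => Real.log_lt_log (sv_pos _ hk) hn, fun n =>
      grOf (isStarProjection_leftProj (k + 1) (ρ (wordProd (letters x.1) 0 n)))
        (trace_leftProj _ hk'), hev.mono fun n hn => (Xi_eq_rangeOf_leftProj _ hk' hn).symm, ?_⟩
    refine tendsto_grOf _ _ _ _ ?_
    rw [tendsto_iff_norm_sub_tendsto_zero]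
    exact squeeze_zero (fun _ => norm_nonneg _) (fun n => hD' n x) hDlim

end Quasigeodesic

theorem QGUnion.continuous_of_continuous_comp_incl {Λ : Type*} [Semigroup Λ] {F : Finset Λ}
    {X : Type*} [TopologicalSpace X] {f : QGUnion F → X}
    (hf : ∀ (κ κ' : ℝ) (h0 : 0 < κ) (h1 : κ ≤ 1) (h' : 0 ≤ κ'),
      Continuous fun x : QG F κ κ' => f (QGUnion.incl h0 h1 h' x)) : Continuous f := by
  refine continuous_iSup_dom.2 fun κ => continuous_iSup_dom.2 fun κ' =>
    continuous_iSup_dom.2 fun h0 => continuous_iSup_dom.2 fun h1 =>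
    continuous_iSup_dom.2 fun h' => continuous_coinduced_dom.2 (hf κ κ' h0 h1 h')

end SemigroupAnosov

end

/-- The index `n` below corresponds to the product `f_0 ⋯ f_n` of the first `n + 1` letters. -/
theorem proposition5p2 {Λ : Type*} [Semigroup Λ] (F : Finset Λ) (hF : Generates F)
    (d i : ℕ) (hi : 1 ≤ i) (hid : i < d) (ρ : Λ →ₙ* GL (Fin d) ℝ) (hρ : IsAnosov ρ i) :
    (∀ κ κ' : ℝ, 0 < κ → κ ≤ 1 → 0 ≤ κ' →
      (qgCocycle ρ F κ κ').HasDominatedSplitting (d - i)) ∧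
    ∃! E : QGUnion F → Gr i d,
      (∀ x : QGUnion F,
        (∀ᶠ n in Filter.atTop, mu (ρ (wordProd (letters x.1) 0 n)) (i + 1) <
          mu (ρ (wordProd (letters x.1) 0 n)) i) ∧
        ConvergesInGr (fun n : ℕ => Xi i (ρ (wordProd (letters x.1) 0 n))) (E x)) ∧
      Continuous E ∧
      (∀ x : QGUnion F,
        (E x).1.map (act (QGUnion.Phi ρ x : Matrix (Fin d) (Fin d) ℝ)) = (E x.shift).1) ∧
      (∀ (κ κ' : ℝ) (h0 : 0 < κ) (h1 : κ ≤ 1) (h' : 0 ≤ κ'),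
        (qgCocycle ρ F κ κ').IsDominatedBundle fun x => E (QGUnion.incl h0 h1 h' x)) := by
  obtain ⟨k, rfl⟩ := Nat.exists_eq_add_of_le' hi
  refine ⟨fun κ κ' h0 _ _ => ?_, ?_⟩
  · obtain ⟨E, hE, _⟩ := exists_isDominatedBundle hF hid hρ h0 κ'
    exact ⟨k + 1, by omega, E, hE⟩
  · have hex : ∀ x : QGUnion F, ∃ V : Gr (k + 1) d,
        (∀ᶠ n in Filter.atTop, mu (ρ (wordProd (letters x.1) 0 n)) (k + 1 + 1) <
          mu (ρ (wordProd (letters x.1) 0 n)) (k + 1)) ∧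
        ConvergesInGr (fun n : ℕ => Xi (k + 1) (ρ (wordProd (letters x.1) 0 n))) V := by
      rintro ⟨x, κ, κ', h0, _, _, hx⟩
      obtain ⟨E, _, hE⟩ := exists_isDominatedBundle hF hid hρ h0 κ'
      exact ⟨E ⟨x, hx⟩, hE ⟨x, hx⟩⟩
    choose E hE using hex
    have hdom : ∀ (κ κ' : ℝ) (h0 : 0 < κ) (h1 : κ ≤ 1) (h' : 0 ≤ κ'),
        (qgCocycle ρ F κ κ').IsDominatedBundle fun x => E (QGUnion.incl h0 h1 h' x) := by
      intro κ κ' h0 h1 h'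
      obtain ⟨E', hE', hlim⟩ := exists_isDominatedBundle hF hid hρ h0 κ'
      -- The limit does not see `κ` and `κ'`; uniqueness of limits glues the bundles of all the
      -- pieces and also gives uniqueness of `E`.
      have e : (fun x => E (QGUnion.incl h0 h1 h' x)) = E' :=
        funext fun x => (hE (QGUnion.incl h0 h1 h' x)).2.unique (hlim x).2
      rwa [e]
    refine ⟨E, ⟨hE, QGUnion.continuous_of_continuous_comp_incl fun κ κ' h0 h1 h' =>
      (hdom κ κ' h0 h1 h').1, ?_, hdom⟩, fun E' hE' => funext fun x =>
        (hE'.1 x).2.unique (hE x).2⟩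
    rintro ⟨x, κ, κ', h0, h1, h', hx⟩
    exact (hdom κ κ' h0 h1 h').2.1 ⟨x, hx⟩
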